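/- Let $A$ be a unital $C^*$-algebra. Then $A$ has a faithful tracial state if and only if $A$ embeds unitally into a von Neumann factor of type $\mathrm{II}_1$, that is, if and only if there are a complex Hilbert space $H$, a factor $M\subseteq B(H)$ of type $\mathrm{II}_1$, and an injective unital $^*$-homomorphism $A\to M$. Here a tracial state on $A$ is a bounded linear functional $\tau\colon A\to\mathbb{C}$ with $\tau(1)=1$, $\tau(x^*x)\ge 0$ and $\tau(x^*x)=\tau(xx^*)$ for all $x\in A$; it is faithful if $\tau(x^*x)=0$ implies $x=0$. A factor is a von Neumann algebra $M\neq 0$ with centre $\mathbb{C}1$. It is of type $\mathrm{II}_1$ if it is finite (a projection $q \in M$ with $1=v^*v$, $q=vv^*$ for some $v\in M$ must equal $1$) and has no nonzero abelian projection (a projection $p\in M$ such that $pMp$ is commutative). -/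

import Mathlib

open scoped ComplexOrder

universe u

/-- A tracial state on a unital C⋆-algebra: a bounded linear functional `τ` that is a state
(positive and unital) and satisfies `τ (x⋆ x) = τ (x x⋆)`. -/
structure IsTracialState {A : Type*} [CStarAlgebra A] (τ : A →L[ℂ] ℂ) : Prop where
  nonneg : ∀ x : A, 0 ≤ τ (star x * x)
  map_one : τ 1 = 1
  trace : ∀ x : A, τ (star x * x) = τ (x * star x)

/-- A positive functional is faithful if it vanishes on no nonzero positive element `x⋆ x`. -/
def IsFaithfulFunctional {A : Type*} [CStarAlgebra A] (τ : A →L[ℂ] ℂ) : Prop :=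
  ∀ x : A, τ (star x * x) = 0 → x = 0

namespace VonNeumannAlgebra

variable {H : Type*} [NormedAddCommGroup H] [InnerProductSpace ℂ H] [CompleteSpace H]

/-- A factor: a nonzero von Neumann algebra whose centre `M ∩ M'` consists of the scalars. -/
structure IsFactor (M : VonNeumannAlgebra H) : Prop where
  one_ne_zero : (1 : H →L[ℂ] H) ≠ 0
  center : ∀ z ∈ M, z ∈ M.commutant → ∃ c : ℂ, z = c • (1 : H →L[ℂ] H)

/-- Murray-von Neumann equivalence of projections relative to `M`: `p = v⋆ v` and `q = v v⋆`
for some (partial isometry) `v` in `M`. -/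
def ProjEquiv (M : VonNeumannAlgebra H) (p q : H →L[ℂ] H) : Prop :=
  ∃ v ∈ M, star v * v = p ∧ v * star v = q

/-- `M` is finite: its identity is a finite projection, that is, `1` is not equivalent to a proper
subprojection. -/
def IsFinite (M : VonNeumannAlgebra H) : Prop :=
  ∀ q ∈ M, IsStarProjection q → M.ProjEquiv 1 q → q = 1

/-- An abelian projection of `M`: a projection `p` in `M` such that `p M p` is commutative. -/
structure IsAbelianProjection (M : VonNeumannAlgebra H) (p : H →L[ℂ] H) : Prop where
  mem : p ∈ M
  isStarProjection : IsStarProjection p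
  comm : ∀ x ∈ M, ∀ y ∈ M, Commute (p * x * p) (p * y * p)

/-- `M` is of type II₁: it is finite and has no nonzero abelian projection. -/
structure IsTypeIIOne (M : VonNeumannAlgebra H) : Prop where
  finite : M.IsFinite
  eq_zero_of_abelian : ∀ p, M.IsAbelianProjection p → p = 0

end VonNeumannAlgebra

/-!
A factor of type `II₁` has a faithful tracial state, which restricts to its unital C⋆-subalgebras.
By comparison of projections and finiteness, for every `κ > 1` a finite factor has a nonzero
projection `g` such that a vector functional is tracial up to the factor `κ` on the partial
isometries of the corner of `g`. Slicing `x⋆ x` into spectral layers extends this from partial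
isometries to all operators, and finitely many partial isometries whose final projections lie
under `g` cover the identity, which spreads the functional to a state that is tracial up to `κ` on
the whole factor. A weak⋆ limit as `κ → 1` is a trace, and it is faithful: otherwise the identity
would be covered by finitely many projections of trace zero.

Conversely, restrict a faithful tracial state to the unitary group of `A`. The resulting character
extends to a product character on the finitary wreath product of the unitary group by the
permutations of `ℕ`, with value zero off the base group. In the two-sided representation attached
to a character, the commutant of the right translations is finite, because a cyclic vector induces
a faithful trace on it. Conjugation by permutations that swap blocks of `ℕ` moves every element of
the wreath product away from every finite set of coordinates, and the resulting mixing shows that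
the commutant is a factor without nonzero abelian projections. Finally, `A` is a quotient of the
group algebra of its unitaries, and the kernel, the null space of `τ (x⋆ x)`, is also the kernel of
the representation; so `A` embeds.
-/

section FunctionalCalculus

variable {A : Type*} [CStarAlgebra A]

theorem semiconjBy_cfc {x a b : A} (ha : IsSelfAdjoint a) (hb : IsSelfAdjoint b)
    (h : SemiconjBy x a b) {f : ℝ → ℝ} (hf : Continuous f) :
    SemiconjBy x (cfc f a) (cfc f b) := by
  let K : Set ℝ := spectrum ℝ a ∪ spectrum ℝ b
  have : CompactSpace K :=
    isCompact_iff_compactSpace.1 ((spectrum.isCompact a).union (spectrum.isCompact b))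
  let φ : C(K, ℝ) →⋆ₐ[ℝ] A := (cfcHom ha).comp
    (ContinuousMap.compStarAlgHom' ℝ ℝ ⟨Set.inclusion Set.subset_union_left, by fun_prop⟩)
  let ψ : C(K, ℝ) →⋆ₐ[ℝ] A := (cfcHom hb).comp
    (ContinuousMap.compStarAlgHom' ℝ ℝ ⟨Set.inclusion Set.subset_union_right, by fun_prop⟩)
  have hφ : Continuous φ := (cfcHom_continuous ha).comp (ContinuousMap.continuous_precomp _)
  have hψ : Continuous ψ := (cfcHom_continuous hb).comp (ContinuousMap.continuous_precomp _)
  have hid : SemiconjBy x (φ (.restrict K (.id ℝ))) (ψ (.restrict K (.id ℝ))) := by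
    convert h
    · exact cfcHom_id ha
    · exact cfcHom_id hb
  -- The functions `g` with `x φ(g) = ψ(g) x` form a closed subalgebra of `C(K, ℝ)`.
  have key (g : C(K, ℝ)) : SemiconjBy x (φ g) (ψ g) := by
    induction g using ContinuousMap.induction_on_of_compact with
    | const r =>
      have hr : ContinuousMap.const K r = algebraMap ℝ C(K, ℝ) r := rfl
      rw [hr, AlgHomClass.commutes, AlgHomClass.commutes]
      exact (Algebra.commutes r x).symm
    | id => exact hid
    | star_id => exact hid
    | add f g hf hg => rw [map_add, map_add]; exact hf.add_right hg
    | mul f g hf hg => rw [map_mul, map_mul]; exact hf.mul_right hg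
    | frequently f hf =>
      exact (isClosed_eq (f := fun g ↦ x * φ g) (g := fun g ↦ ψ g * x) (by fun_prop)
        (by fun_prop)).mem_of_frequently_of_tendsto hf Filter.tendsto_id
  rw [cfc_apply f a ha, cfc_apply f b hb]
  exact key ⟨fun t ↦ f t, by fun_prop⟩

theorem mul_cfc_star_mul_self (x : A) {f : ℝ → ℝ} (hf : Continuous f) :
    x * cfc f (star x * x) = cfc f (x * star x) * x :=
  semiconjBy_cfc (.star_mul_self x) (.mul_star_self x) (mul_assoc x (star x) x).symm hf

end FunctionalCalculus

/-- Partial isometries of a semigroup with involution, characterized algebraically by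
`v v⋆ v = v`. -/
def IsPartialIsometry {R : Type*} [Mul R] [Star R] (v : R) : Prop := v * star v * v = v

namespace IsPartialIsometry

variable {R : Type*} [Semigroup R] [StarMul R] {v p : R}

theorem mul_initial (hv : IsPartialIsometry v) : v * (star v * v) = v := by
  rw [← mul_assoc]; exact hv

protected theorem star (hv : IsPartialIsometry v) : IsPartialIsometry (star v) := by
  simpa [IsPartialIsometry, mul_assoc] using congrArg star hv

theorem star_mul_final (hv : IsPartialIsometry v) : star v * (v * star v) = star v := by
  simpa using hv.star.mul_initial

theorem isStarProjection_initial (hv : IsPartialIsometry v) : IsStarProjection (star v * v) where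
  isIdempotentElem := by rw [IsIdempotentElem, mul_assoc, hv.mul_initial]
  isSelfAdjoint := .star_mul_self v

theorem isStarProjection_final (hv : IsPartialIsometry v) : IsStarProjection (v * star v) := by
  simpa using hv.star.isStarProjection_initial

theorem of_isStarProjection (hp : IsStarProjection p) : IsPartialIsometry p := by
  simp [IsPartialIsometry, hp.isSelfAdjoint.star_eq, hp.isIdempotentElem.eq]

theorem mul_projection (hp : IsStarProjection p) (h : star v * v * p = p) :
    IsPartialIsometry (v * p) := by
  rw [IsPartialIsometry, star_mul, hp.isSelfAdjoint.star_eq]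
  calc v * p * (p * star v) * (v * p) = v * (p * p) * (star v * v * p) := by
        simp only [mul_assoc]
    _ = v * p := by rw [h, hp.isIdempotentElem.eq, mul_assoc, hp.isIdempotentElem.eq]

theorem of_isStarProjection_star_mul_self {A : Type*} [NormedRing A] [StarRing A] [CStarRing A]
    {v : A} (h : IsStarProjection (star v * v)) : IsPartialIsometry v := by
  rw [IsPartialIsometry, mul_assoc, ← sub_eq_zero, ← CStarRing.star_mul_self_eq_zero_iff]
  set p := star v * v with hp
  calc star (v * p - v) * (v * p - v) = p * p * p - p * p - p * p + p := by
        rw [star_sub, star_mul, h.isSelfAdjoint.star_eq, sub_mul, mul_sub, mul_sub]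
        simp only [hp, mul_assoc]; abel
    _ = 0 := by simp [h.isIdempotentElem.eq]

end IsPartialIsometry

section Hilbert

variable {H : Type*} [NormedAddCommGroup H] [InnerProductSpace ℂ H] [CompleteSpace H]

local notation "⟪" x ", " y "⟫" => inner ℂ x y

theorem inner_star_apply_right (a : H →L[ℂ] H) (x y : H) : ⟪x, star a y⟫ = ⟪a x, y⟫ :=
  a.adjoint_inner_right x y

theorem inner_star_mul_self_apply (a : H →L[ℂ] H) (x y : H) :
    ⟪x, (star a * a) y⟫ = ⟪a x, a y⟫ := inner_star_apply_right a x (a y)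

theorem re_inner_star_mul_self (a : H →L[ℂ] H) (x : H) : (⟪x, (star a * a) x⟫).re = ‖a x‖ ^ 2 := by
  rw [inner_star_mul_self_apply]
  exact inner_self_eq_norm_sq (𝕜 := ℂ) (a x)

theorem norm_apply_eq_of_star_mul_self_eq {a b : H →L[ℂ] H} (h : star a * a = star b * b) (x : H) :
    ‖a x‖ = ‖b x‖ := by
  rw [← sq_eq_sq₀ (norm_nonneg _) (norm_nonneg _), ← re_inner_star_mul_self, h,
    re_inner_star_mul_self]

theorem star_mul_self_apply_eq_zero_iff {a : H →L[ℂ] H} {x : H} :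
    (star a * a) x = 0 ↔ a x = 0 := by
  refine ⟨fun h ↦ inner_self_eq_zero (𝕜 := ℂ).1 ?_, fun h ↦ ?_⟩
  · rw [← inner_star_mul_self_apply, h, inner_zero_right]
  · rw [mul_apply_eq_comp, h, map_zero]

omit [CompleteSpace H] in
theorem mul_eq_zero_of_ker_le {v y p : H →L[ℂ] H} (h : ∀ η, y η = 0 → v η = 0)
    (hyp : y * p = 0) : v * p = 0 := by
  ext η
  exact h _ (DFunLike.congr_fun hyp η)

omit [CompleteSpace H] in
theorem mul_eq_self_of_ker_le {v y p : H →L[ℂ] H} (h : ∀ η, y η = 0 → v η = 0)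
    (hyp : y * p = y) : v * p = v := by
  rw [← sub_eq_zero, ← mul_sub_one] at hyp ⊢
  exact mul_eq_zero_of_ker_le h hyp

/-- `v` is a partial isometry with the same left and right support projections as `y`; the polar
part of `y` is one. Kernels stand in for the support projections, so that the latter need not be
constructed. -/
structure IsSupportIsometry (v y : H →L[ℂ] H) : Prop where
  isPartialIsometry : IsPartialIsometry v
  apply_eq_zero_iff : ∀ η, v η = 0 ↔ y η = 0
  star_apply_eq_zero_iff : ∀ η, star v η = 0 ↔ star y η = 0

namespace IsSupportIsometry

variable {v y p : H →L[ℂ] H}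

protected theorem star (h : IsSupportIsometry v y) : IsSupportIsometry (star v) (star y) where
  isPartialIsometry := h.isPartialIsometry.star
  apply_eq_zero_iff := h.star_apply_eq_zero_iff
  star_apply_eq_zero_iff := by simpa only [star_star] using h.apply_eq_zero_iff

theorem mul_initial (h : IsSupportIsometry v y) : y * (star v * v) = y :=
  mul_eq_self_of_ker_le (fun η ↦ (h.apply_eq_zero_iff η).1) h.isPartialIsometry.mul_initial

theorem mul_eq_self (h : IsSupportIsometry v y) (hyp : y * p = y) : v * p = v :=
  mul_eq_self_of_ker_le (fun η ↦ (h.apply_eq_zero_iff η).2) hyp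

theorem eq_mul_self (h : IsSupportIsometry v y) (hp : IsSelfAdjoint p) (hpy : p * y = y) :
    p * v = v := by
  have := h.star.mul_eq_self (p := p) (by rw [← hp.star_eq, ← star_mul, hpy])
  simpa [hp.star_eq] using congrArg star this

end IsSupportIsometry

theorem exists_partialIsometry_of_norm_eq {E : Type*} [AddCommGroup E] [Module ℂ E]
    {e f : E →ₗ[ℂ] H} (h : ∀ x, ‖f x‖ = ‖e x‖) : ∃ V : H →L[ℂ] H, (∀ x, V (e x) = f x) ∧
      star V * V = e.range.topologicalClosure.starProjection := by
  set K := e.range.topologicalClosure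
  let e' : E →ₗ[ℂ] K := e.codRestrict K fun x ↦ e.range.le_topologicalClosure ⟨x, rfl⟩
  have hdense : DenseRange e' := by
    rw [DenseRange, Subtype.dense_iff, ← Set.range_comp]
    exact subset_rfl
  let W : K →L[ℂ] H := f.extendOfNorm e'
  have hW (x : E) : W (e' x) = f x :=
    f.extendOfNorm_eq hdense ⟨1, fun x ↦ ((one_mul _).trans (h x).symm).ge⟩ x
  have hnorm (k : K) : ‖W k‖ = ‖k‖ := by
    refine hdense.induction_on (p := fun k ↦ ‖W k‖ = ‖k‖) k ?_ fun x ↦ ?_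
    · exact isClosed_eq (by fun_prop) (by fun_prop)
    · rw [hW, h]; rfl
  refine ⟨W ∘L K.orthogonalProjectionOnto, fun x ↦ ?_, ?_⟩
  · rw [ContinuousLinearMap.comp_apply, ← hW]
    exact congrArg W (K.orthogonalProjectionOnto_mem_subspace_eq_self (e' x))
  · ext ξ
    refine ext_inner_left ℂ fun η ↦ ?_
    rw [inner_star_mul_self_apply, ContinuousLinearMap.comp_apply, ContinuousLinearMap.comp_apply,
      W.inner_map_map_iff_adjoint_comp_self.2 (W.norm_map_iff_adjoint_comp_self.1 hnorm)]
    exact K.inner_orthogonalProjectionOnto_eq_of_mem_right (K.orthogonalProjectionOnto ξ) η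

theorem eq_zero_of_mul_eq_zero_of_ker_le {a S : H →L[ℂ] H} (ha : IsSelfAdjoint a)
    (hSa : S * a = 0) (hker : ∀ η, a η = 0 → S η = 0) : S = 0 := by
  have haS : a * star S = 0 := by
    rw [← ha.star_eq, ← star_mul, hSa, star_zero]
  have hSS : S * star S = 0 := by
    ext η
    exact hker _ (DFunLike.congr_fun haS η)
  rwa [CStarRing.mul_star_self_eq_zero_iff] at hSS

theorem exists_polar_decomposition (y : H →L[ℂ] H) :
    ∃ v : H →L[ℂ] H, IsSupportIsometry v y ∧ v * CFC.abs y = y := by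
  set a := CFC.abs y
  have ha : IsSelfAdjoint a := .of_nonneg (CFC.abs_nonneg y)
  have haa : star a * a = star y * y := by rw [ha.star_eq, CFC.abs_mul_abs]
  have hker (η : H) : a η = 0 ↔ y η = 0 := by
    rw [← star_mul_self_apply_eq_zero_iff, haa, star_mul_self_apply_eq_zero_iff]
  have hnorm (η : H) : ‖y η‖ = ‖a η‖ := (norm_apply_eq_of_star_mul_self_eq haa η).symm
  obtain ⟨v, hva, hvv⟩ := exists_partialIsometry_of_norm_eq (e := a.toLinearMap)
    (f := y.toLinearMap) hnorm
  have hv : IsPartialIsometry v := .of_isStarProjection_star_mul_self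
    (hvv ▸ isStarProjection_starProjection)
  have hvy : v * a = y := ContinuousLinearMap.ext hva
  have hvker (η : H) : v η = 0 ↔ y η = 0 := by
    rw [← star_mul_self_apply_eq_zero_iff, hvv, Submodule.starProjection_apply_eq_zero_iff, ← hker,
      Submodule.orthogonal_closure, a.orthogonal_range, ← ContinuousLinearMap.star_eq_adjoint,
      ha.star_eq]
    rfl
  have hstar : star y = a * star v := by rw [← hvy, star_mul, ha.star_eq]
  refine ⟨v, ⟨hv, hvker, fun η ↦ ⟨fun h ↦ ?_, fun h ↦ ?_⟩⟩, hvy⟩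
  · rw [hstar, mul_apply_eq_comp, h, map_zero]
  · have : v (star v η) = 0 := by rwa [hvker, ← hker, ← mul_apply_eq_comp, ← hstar]
    rw [← hv.star_mul_final, mul_apply_eq_comp, mul_apply_eq_comp, this, map_zero]

theorem commute_polar_part {a y v T : H →L[ℂ] H} (ha : IsSelfAdjoint a) (hva : v * a = y)
    (hker : ∀ η, a η = 0 ↔ v η = 0) (hTa : Commute T a) (hTy : Commute T y) : Commute T v := by
  refine sub_eq_zero.1 (eq_zero_of_mul_eq_zero_of_ker_le ha ?_ fun η hη ↦ ?_)
  · rw [sub_mul, mul_assoc, hva, mul_assoc, hTa.eq, ← mul_assoc, hva, hTy.eq, sub_self]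
  · have haT : a (T η) = 0 := by
      rw [← mul_apply_eq_comp, ← hTa.eq, mul_apply_eq_comp, hη, map_zero]
    simp [(hker _).1 haT, (hker _).1 hη]

variable {M : VonNeumannAlgebra H}

theorem mem_of_forall_commute {x : H →L[ℂ] H} (h : ∀ T ∈ M.commutant, Commute T x) : x ∈ M := by
  rw [← M.commutant_commutant, VonNeumannAlgebra.mem_commutant_iff]; exact h

theorem commute_of_mem_commutant {x T : H →L[ℂ] H} (hT : T ∈ M.commutant) (hx : x ∈ M) :
    Commute T x := (VonNeumannAlgebra.mem_commutant_iff.1 hT x hx).symm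

theorem cfc_mem_vonNeumannAlgebra {a : H →L[ℂ] H} (ha : a ∈ M) (f : ℝ → ℝ) : cfc f a ∈ M :=
  mem_of_forall_commute fun _ hT ↦ ((commute_of_mem_commutant hT ha).symm.cfc_real f).symm

theorem exists_isSupportIsometry_mem {y : H →L[ℂ] H} (hy : y ∈ M) :
    ∃ v ∈ M, IsSupportIsometry v y := by
  obtain ⟨v, hv, hvy⟩ := exists_polar_decomposition y
  have ha : IsSelfAdjoint (CFC.abs y) := .of_nonneg (CFC.abs_nonneg y)
  refine ⟨v, mem_of_forall_commute fun T hT ↦ ?_, hv⟩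
  have hTy : Commute T y := commute_of_mem_commutant hT hy
  have hTy' : Commute (star T) y := commute_of_mem_commutant (star_mem hT) hy
  refine commute_polar_part ha hvy (fun η ↦ ?_) (hTy.symm.cfcAbs_left hTy'.symm).symm hTy
  rw [hv.apply_eq_zero_iff, ← star_mul_self_apply_eq_zero_iff, ha.star_eq, CFC.abs_mul_abs,
    star_mul_self_apply_eq_zero_iff]

end Hilbert

section SpectralLayers

section CStarAlgebra

variable {A : Type*} [CStarAlgebra A] [PartialOrder A] [StarOrderedRing A] {h p : A} {c : ℝ}

theorem le_smul_projection_of_mul_eq (hp : IsStarProjection p) (hh : 0 ≤ h) (hc : h ≤ c • 1)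
    (hhp : h * p = h) : h ≤ c • p := by
  have hph : p * h = h := by
    simpa [hp.isSelfAdjoint.star_eq, (IsSelfAdjoint.of_nonneg hh).star_eq] using congrArg star hhp
  simpa [hp.isSelfAdjoint.star_eq, hph, hhp, hp.isIdempotentElem.eq] using
    star_left_conjugate_le_conjugate hc p

theorem smul_projection_le_of_mul_eq (hp : IsStarProjection p) (hh : 0 ≤ h)
    (hph : p * h = c • p) : c • p ≤ h := by
  have hhp : h * p = c • p := by
    simpa [hp.isSelfAdjoint.star_eq, (IsSelfAdjoint.of_nonneg hh).star_eq] using congrArg star hph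
  have hcompl : (1 - p) * h * (1 - p) = h - c • p := by
    simp [sub_mul, mul_sub, hph, hhp, hp.isIdempotentElem.eq]
  simpa [hp.isSelfAdjoint.star_eq, hcompl] using star_left_conjugate_nonneg hh (1 - p)

theorem star_mul_self_le_one {x : A} (hx : ‖x‖ ≤ 1) : star x * x ≤ 1 := by
  rw [← CStarAlgebra.norm_le_one_iff_of_nonneg _ (star_mul_self_nonneg x),
    CStarRing.norm_star_mul_self]
  exact mul_le_one₀ hx (norm_nonneg x) hx

end CStarAlgebra

/-- The part of the real number `t` between the levels `s` and `s + c`. Applied to a positive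
operator through the functional calculus, it cuts the operator into horizontal layers. -/
def slice (s c t : ℝ) : ℝ := min t (s + c) - min t s

section Slice

variable {s c : ℝ}

@[fun_prop]
theorem continuous_slice (s c : ℝ) : Continuous (slice s c) := by unfold slice; fun_prop

theorem slice_nonneg (hc : 0 ≤ c) (s t : ℝ) : 0 ≤ slice s c t :=
  sub_nonneg.2 (min_le_min_left t (by linarith))

theorem slice_le (hc : 0 ≤ c) (s t : ℝ) : slice s c t ≤ c := by unfold slice; grind

theorem slice_le_max_sub (hc : 0 ≤ c) (t : ℝ) : slice s c t ≤ max (t - s) 0 := by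
  unfold slice; grind

theorem slice_le_self (hs : 0 ≤ s) {t : ℝ} (ht : 0 ≤ t) : slice s c t ≤ t := by
  unfold slice; grind

theorem max_sub_mul_slice (hc : 0 ≤ c) (t : ℝ) :
    max (t - (s + c)) 0 * slice s c t = max (t - (s + c)) 0 * c := by
  rcases le_total t (s + c) with h | h
  · simp [max_eq_right (sub_nonpos.2 h)]
  · rw [slice, min_eq_right h, min_eq_right (by linarith), add_sub_cancel_left]

theorem sum_slice {n : ℕ} (hn : 0 < n) {t : ℝ} (h0 : 0 ≤ t) (h1 : t ≤ 1) :
    ∑ k ∈ Finset.range n, slice (k / n) (n : ℝ)⁻¹ t = t := by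
  have hslice (k : ℕ) :
      slice (k / n) (n : ℝ)⁻¹ t = min t ((k + 1 : ℕ) / n) - min t (k / n) := by
    unfold slice; congr 2; push_cast; ring
  simp_rw [hslice]
  rw [Finset.sum_range_sub (fun k : ℕ ↦ min t ((k : ℝ) / n)), div_self (by positivity)]
  simp [h0, h1]

end Slice

variable {H : Type*} [NormedAddCommGroup H] [InnerProductSpace ℂ H] [CompleteSpace H]

theorem apply_eq_zero_of_star_mul_self_le {a b : H →L[ℂ] H} (h : star a * a ≤ star b * b) {η : H}
    (hη : b η = 0) : a η = 0 := by
  have hre := ((ContinuousLinearMap.le_def _ _).1 h).re_inner_nonneg_right η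
  rw [sub_apply, inner_sub_right, inner_star_mul_self_apply, inner_star_mul_self_apply, hη,
    inner_zero_left, zero_sub, map_neg, inner_self_eq_norm_sq] at hre
  exact norm_eq_zero.1 (pow_eq_zero_iff two_ne_zero |>.1 (by linarith [sq_nonneg ‖a η‖]))

/-- `x (x⋆x - s)₊`: its support projections are the spectral projections of `x⋆x` and `xx⋆` for
`(s, ∞)`. -/
noncomputable def cutdown (x : H →L[ℂ] H) (s : ℝ) : H →L[ℂ] H :=
  x * cfc (fun t : ℝ ↦ max (t - s) 0) (star x * x)

variable {x v : H →L[ℂ] H} {s c : ℝ}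

theorem star_cutdown (x : H →L[ℂ] H) (s : ℝ) : star (cutdown x s) = cutdown (star x) s := by
  rw [cutdown, mul_cfc_star_mul_self x (by fun_prop), star_mul, cutdown, star_star,
    (cfc_predicate (R := ℝ) (p := IsSelfAdjoint) _ (x * star x)).star_eq]

theorem star_cutdown_mul_self (x : H →L[ℂ] H) (s : ℝ) :
    star (cutdown x s) * cutdown x s =
      cfc (fun t : ℝ ↦ max (t - s) 0 * t * max (t - s) 0) (star x * x) := by
  have ha : IsSelfAdjoint (star x * x) := .star_mul_self x
  rw [cutdown, star_mul, (cfc_predicate (R := ℝ) (p := IsSelfAdjoint) _ (star x * x)).star_eq,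
    cfc_mul (fun t : ℝ ↦ max (t - s) 0 * t) (fun t ↦ max (t - s) 0) (star x * x),
    cfc_mul (fun t : ℝ ↦ max (t - s) 0) (fun t ↦ t) (star x * x), cfc_id' ℝ (star x * x)]
  simp only [mul_assoc]

theorem cfc_slice_nonneg (hc : 0 ≤ c) (a : H →L[ℂ] H) : 0 ≤ cfc (slice s c) a :=
  cfc_nonneg fun t _ ↦ slice_nonneg hc s t

theorem cfc_slice_apply_eq_zero (hs : 0 ≤ s) (hc : 0 ≤ c) (hc1 : c ≤ 1) {η : H}
    (hη : cutdown x s η = 0) : cfc (slice s c) (star x * x) η = 0 := by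
  set a := star x * x
  set h := cfc (slice s c) a with hh
  have hsa : star h = h := (IsSelfAdjoint.of_nonneg (cfc_slice_nonneg hc a)).star_eq
  have hle : star (h * h) * (h * h) ≤ star (cutdown x s) * cutdown x s := by
    rw [star_cutdown_mul_self, star_mul, hsa, hh, ← cfc_mul (slice s c) (slice s c) a,
      ← cfc_mul ..]
    refine cfc_mono fun t ht ↦ ?_
    have ht0 : 0 ≤ t := spectrum_nonneg_of_nonneg (star_mul_self_nonneg x) ht
    have h0 := slice_nonneg hc s t
    have hle1 := (slice_le hc s t).trans hc1
    have hlet := slice_le_self (c := c) hs ht0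
    have hlemax := slice_le_max_sub (s := s) hc t
    calc slice s c t * slice s c t * (slice s c t * slice s c t)
        ≤ max (t - s) 0 * t * (max (t - s) 0 * 1) := by gcongr
      _ = max (t - s) 0 * t * max (t - s) 0 := by ring
  have := apply_eq_zero_of_star_mul_self_le hle hη
  rwa [← star_mul_self_apply_eq_zero_iff, hsa]

theorem cfc_slice_le_smul (hs : 0 ≤ s) (hc : 0 ≤ c) (hc1 : c ≤ 1)
    (hv : IsSupportIsometry v (cutdown x s)) :
    cfc (slice s c) (star x * x) ≤ c • (star v * v) := by
  refine le_smul_projection_of_mul_eq hv.isPartialIsometry.isStarProjection_initial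
    (cfc_slice_nonneg hc _) ?_ ?_
  · calc cfc (slice s c) (star x * x) ≤ cfc (fun _ ↦ c) (star x * x) :=
          cfc_mono fun t _ ↦ slice_le hc s t
      _ = c • 1 := by rw [cfc_const c (star x * x), Algebra.algebraMap_eq_smul_one]
  · exact mul_eq_self_of_ker_le (fun η ↦ cfc_slice_apply_eq_zero hs hc hc1) hv.mul_initial

theorem smul_le_cfc_slice (hc : 0 ≤ c) (hv : IsSupportIsometry v (cutdown x (s + c))) :
    c • (star v * v) ≤ cfc (slice s c) (star x * x) := by
  refine smul_projection_le_of_mul_eq hv.isPartialIsometry.isStarProjection_initial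
    (cfc_slice_nonneg hc _) ?_
  have hcut : cutdown x (s + c) * cfc (slice s c) (star x * x) = c • cutdown x (s + c) := by
    rw [cutdown, mul_assoc, ← cfc_mul .., ← mul_smul_comm, ← cfc_smul ..]
    congr 1
    exact cfc_congr fun t _ ↦ (max_sub_mul_slice hc t).trans (mul_comm _ _)
  have hv0 : v * (cfc (slice s c) (star x * x) - c • 1) = 0 :=
    mul_eq_zero_of_ker_le (fun η ↦ (hv.apply_eq_zero_iff η).2)
      (by rw [mul_sub, hcut, mul_smul_comm, mul_one, sub_self])
  rw [mul_sub, mul_smul_comm, mul_one, sub_eq_zero] at hv0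
  rw [mul_assoc, hv0, mul_smul_comm]

theorem sum_cfc_slice {a : H →L[ℂ] H} (ha0 : 0 ≤ a) (ha1 : a ≤ 1) {n : ℕ} (hn : 0 < n) :
    ∑ k ∈ Finset.range n, cfc (slice (k / n) (n : ℝ)⁻¹) a = a := by
  have hsa := IsSelfAdjoint.of_nonneg ha0
  rw [← cfc_sum (a := a) (fun k : ℕ ↦ slice (k / n) (n : ℝ)⁻¹) _
    fun k _ ↦ (continuous_slice _ _).continuousOn]
  conv_rhs => rw [← cfc_id' ℝ a]
  refine cfc_congr fun t ht ↦ ?_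
  have ht1 : t ≤ 1 := (le_algebraMap_iff_spectrum_le (r := (1 : ℝ)) (a := a)).1
    (by simpa using ha1) t ht
  simpa only [Finset.sum_apply] using sum_slice hn (spectrum_nonneg_of_nonneg ha0 ht) ht1

theorem star_mul_self_le_smul_sum (hx : ‖x‖ ≤ 1) {n : ℕ} (hn : 0 < n) {v : ℕ → H →L[ℂ] H}
    (hv : ∀ k : ℕ, IsSupportIsometry (v k) (cutdown x (k / n))) :
    star x * x ≤ (n : ℝ)⁻¹ • ∑ k ∈ Finset.range n, star (v k) * v k := by
  have hn1 : (n : ℝ)⁻¹ ≤ 1 := inv_le_one_of_one_le₀ (by exact_mod_cast hn)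
  conv_lhs => rw [← sum_cfc_slice (star_mul_self_nonneg x) (star_mul_self_le_one hx) hn]
  rw [Finset.smul_sum]
  gcongr with k
  exact cfc_slice_le_smul (by positivity) (by positivity) hn1 (hv k)

theorem smul_sum_le_star_mul_self (hx : ‖x‖ ≤ 1) {n : ℕ} (hn : 0 < n) {v : ℕ → H →L[ℂ] H}
    (hv : ∀ k : ℕ, IsSupportIsometry (v k) (cutdown x (k / n))) :
    (n : ℝ)⁻¹ • ∑ k ∈ Finset.range n, star (v (k + 1)) * v (k + 1) ≤ star x * x := by
  conv_rhs => rw [← sum_cfc_slice (star_mul_self_nonneg x) (star_mul_self_le_one hx) hn]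
  rw [Finset.smul_sum]
  gcongr with k
  have hk : ((k + 1 : ℕ) : ℝ) / n = k / n + (n : ℝ)⁻¹ := by push_cast; ring
  exact smul_le_cfc_slice (by positivity) (hk ▸ hv (k + 1))

/-- The same partial isometries control `x⋆x` and `xx⋆`, which is what transports an estimate for
partial isometries to arbitrary operators. -/
theorem exists_layers {M : VonNeumannAlgebra H} {g : H →L[ℂ] H} (hx : x ∈ M) (hx1 : ‖x‖ ≤ 1)
    (hg : IsSelfAdjoint g) (hxg : x * g = x) (hgx : g * x = x) {n : ℕ} (hn : 0 < n) :
    ∃ v : ℕ → H →L[ℂ] H,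
      (∀ k, v k ∈ M ∧ IsPartialIsometry (v k) ∧ v k * g = v k ∧ g * v k = v k) ∧
      star x * x ≤ (n : ℝ)⁻¹ • ∑ k ∈ Finset.range n, star (v k) * v k ∧
      (n : ℝ)⁻¹ • ∑ k ∈ Finset.range n, star (v (k + 1)) * v (k + 1) ≤ star x * x ∧
      (n : ℝ)⁻¹ • ∑ k ∈ Finset.range n, v (k + 1) * star (v (k + 1)) ≤ x * star x := by
  have hcut (s : ℝ) : cutdown x s ∈ M :=
    mul_mem hx (cfc_mem_vonNeumannAlgebra (mul_mem (star_mem hx) hx) _)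
  choose v hvM hv using fun k : ℕ ↦ exists_isSupportIsometry_mem (hcut (k / n))
  have hcomm : Commute (star x * x) g := by
    have hgsx : g * star x = star x := by rw [← hg.star_eq, ← star_mul, hxg]
    rw [Commute, SemiconjBy, mul_assoc, hxg, ← mul_assoc, hgsx]
  have hcutg (s : ℝ) : cutdown x s * g = cutdown x s := by
    rw [cutdown, mul_assoc, (hcomm.cfc_real _).eq, ← mul_assoc, hxg]
  have hgcut (s : ℝ) : g * cutdown x s = cutdown x s := by rw [cutdown, ← mul_assoc, hgx]
  refine ⟨v, fun k ↦ ⟨hvM k, (hv k).isPartialIsometry, (hv k).mul_eq_self (hcutg _),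
    (hv k).eq_mul_self hg (hgcut _)⟩, star_mul_self_le_smul_sum hx1 hn hv,
    smul_sum_le_star_mul_self hx1 hn hv, ?_⟩
  have hv' (k : ℕ) : IsSupportIsometry (star (v k)) (cutdown (star x) (k / n)) :=
    star_cutdown x _ ▸ (hv k).star
  simpa only [star_star] using smul_sum_le_star_mul_self (by rwa [norm_star]) hn hv'

end SpectralLayers

section StrongSums

variable {H : Type*} [NormedAddCommGroup H] [InnerProductSpace ℂ H] {ι : Type*}

local notation "⟪" x ", " y "⟫" => inner ℂ x y

/-- `V` is the sum of the family `v` in the strong operator topology. -/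
def HasStrongSum (v : ι → H →L[ℂ] H) (V : H →L[ℂ] H) : Prop :=
  ∀ ξ, HasSum (fun i ↦ v i ξ) (V ξ)

namespace HasStrongSum

variable {v : ι → H →L[ℂ] H} {V W : H →L[ℂ] H}

theorem unique (hV : HasStrongSum v V) (hW : HasStrongSum v W) : V = W :=
  ContinuousLinearMap.ext fun ξ ↦ (hV ξ).unique (hW ξ)

theorem mul_left (hV : HasStrongSum v V) (T : H →L[ℂ] H) :
    HasStrongSum (fun i ↦ T * v i) (T * V) :=
  fun ξ ↦ T.hasSum (hV ξ)

theorem mul_right (hV : HasStrongSum v V) (T : H →L[ℂ] H) :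
    HasStrongSum (fun i ↦ v i * T) (V * T) :=
  fun ξ ↦ hV (T ξ)

theorem mul_eq_mul (hV : HasStrongSum v V) {S T : H →L[ℂ] H} (h : ∀ i, T * v i = v i * S) :
    T * V = V * S :=
  (hV.mul_left T).unique <| by simpa only [h] using hV.mul_right S

theorem mul_eq_self (hV : HasStrongSum v V) {T : H →L[ℂ] H} (h : ∀ i, v i * T = v i) :
    V * T = V := by
  simpa using (hV.mul_eq_mul (T := 1) (S := T) fun i ↦ by rw [one_mul, h]).symm

theorem eq_mul_self (hV : HasStrongSum v V) {T : H →L[ℂ] H} (h : ∀ i, T * v i = v i) :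
    T * V = V := by
  simpa using hV.mul_eq_mul (T := T) (S := 1) fun i ↦ by rw [mul_one, h]

theorem mul_eq_single (hV : HasStrongSum v V) {T : H →L[ℂ] H} {i : ι}
    (h : ∀ j, j ≠ i → T * v j = 0) : T * V = T * v i :=
  (hV.mul_left T).unique fun ξ ↦ hasSum_single i fun j hj ↦ DFunLike.congr_fun (h j hj) ξ

variable [CompleteSpace H]

theorem mem {M : VonNeumannAlgebra H} (hV : HasStrongSum v V) (h : ∀ i, v i ∈ M) : V ∈ M :=
  mem_of_forall_commute fun _ hT ↦ hV.mul_eq_mul fun i ↦ commute_of_mem_commutant hT (h i)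

theorem eq_star (hV : HasStrongSum v V) (hW : HasStrongSum (fun i ↦ star (v i)) W) :
    W = star V := by
  ext ξ
  refine ext_inner_left ℂ fun η ↦ ((innerSL ℂ η).hasSum (hW ξ)).unique ?_
  simpa [inner_star_apply_right] using ((innerSL ℂ ξ).hasSum (hV η)).star

end HasStrongSum

theorem isStarProjection_sum {R : Type*} [NonUnitalRing R] [StarRing R] {p : ι → R}
    (hp : ∀ i, IsStarProjection (p i)) (h : Pairwise fun i j ↦ p i * p j = 0) (s : Finset ι) :
    IsStarProjection (∑ i ∈ s, p i) := by
  classical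
  induction s using Finset.induction_on with
  | empty => exact .zero R
  | insert a s ha ih =>
    rw [Finset.sum_insert ha]
    refine (hp a).add ih ?_
    rw [Finset.mul_sum]
    exact Finset.sum_eq_zero fun i hi ↦ h (ne_of_mem_of_not_mem hi ha).symm

/-- Families of partial isometries whose initial projections are pairwise orthogonal and whose final
projections are pairwise orthogonal. -/
structure IsOrthogonalFamily {R : Type*} [MulZeroClass R] [Star R] (v : ι → R) : Prop where
  isPartialIsometry : ∀ i, IsPartialIsometry (v i)
  mul_star_eq_zero : Pairwise fun i j ↦ v i * star (v j) = 0
  star_mul_eq_zero : Pairwise fun i j ↦ star (v i) * v j = 0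

namespace IsOrthogonalFamily

variable [CompleteSpace H] {v : ι → H →L[ℂ] H} {V : H →L[ℂ] H}

protected theorem star (hv : IsOrthogonalFamily v) : IsOrthogonalFamily fun i ↦ star (v i) where
  isPartialIsometry i := (hv.isPartialIsometry i).star
  mul_star_eq_zero := by simpa only [star_star] using hv.star_mul_eq_zero
  star_mul_eq_zero := by simpa only [star_star] using hv.mul_star_eq_zero

theorem orthogonalFamily_range (hv : IsOrthogonalFamily v) :
    OrthogonalFamily ℂ (fun i ↦ (v i).range) fun i ↦ (v i).range.subtypeₗᵢ := by
  rintro i j hij ⟨-, x, rfl⟩ ⟨-, y, rfl⟩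
  change ⟪v i x, v j y⟫ = 0
  rw [← inner_star_apply_right, ← mul_apply_eq_comp, hv.star_mul_eq_zero hij, zero_apply,
    inner_zero_right]

theorem norm_sq_sum_apply (hv : IsOrthogonalFamily v) (s : Finset ι) (ξ : H) :
    ‖∑ i ∈ s, v i ξ‖ ^ 2 = ∑ i ∈ s, ‖v i ξ‖ ^ 2 :=
  hv.orthogonalFamily_range.norm_sum (fun i ↦ ⟨v i ξ, ξ, rfl⟩) s

theorem sum_norm_sq_apply_le (hv : IsOrthogonalFamily v) (s : Finset ι) (ξ : H) :
    ∑ i ∈ s, ‖v i ξ‖ ^ 2 ≤ ‖ξ‖ ^ 2 := by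
  set p := ∑ i ∈ s, star (v i) * v i
  have hp : IsStarProjection p := by
    refine isStarProjection_sum (fun i ↦ (hv.isPartialIsometry i).isStarProjection_initial)
      (fun i j hij ↦ ?_) s
    beta_reduce
    rw [mul_assoc, ← mul_assoc (v i), hv.mul_star_eq_zero hij, zero_mul, mul_zero]
  calc ∑ i ∈ s, ‖v i ξ‖ ^ 2 = (⟪ξ, p ξ⟫).re := by
        rw [sum_apply, inner_sum, Complex.re_sum]
        refine Finset.sum_congr rfl fun i _ ↦ ?_
        exact (re_inner_star_mul_self (v i) ξ).symm
    _ = ‖p ξ‖ ^ 2 := by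
        rw [← re_inner_star_mul_self, hp.isSelfAdjoint.star_eq, hp.isIdempotentElem.eq]
    _ ≤ ‖ξ‖ ^ 2 := by
        gcongr
        exact (p.le_of_opNorm_le hp.norm_le ξ).trans (one_mul _).le

theorem exists_hasStrongSum (hv : IsOrthogonalFamily v) : ∃ V, HasStrongSum v V := by
  have hsum (ξ : H) : Summable fun i ↦ v i ξ :=
    (hv.orthogonalFamily_range.summable_iff_norm_sq_summable fun i ↦ ⟨v i ξ, ξ, rfl⟩).2
      (summable_of_sum_le (fun i ↦ by positivity) fun s ↦ hv.sum_norm_sq_apply_le s ξ)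
  let L : H →ₗ[ℂ] H :=
    { toFun ξ := ∑' i, v i ξ
      map_add' ξ η := by simp only [map_add]; exact (hsum ξ).tsum_add (hsum η)
      map_smul' c ξ := by simp only [map_smul, RingHom.id_apply]; exact (hsum ξ).tsum_const_smul c }
  refine ⟨L.mkContinuous 1 fun ξ ↦ ?_, fun ξ ↦ (hsum ξ).hasSum⟩
  rw [one_mul]
  refine le_of_tendsto (hsum ξ).hasSum.norm (.of_forall fun s ↦ ?_)
  exact le_of_sq_le_sq (hv.norm_sq_sum_apply s ξ ▸ hv.sum_norm_sq_apply_le s ξ) (norm_nonneg ξ)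

theorem hasStrongSum_star (hv : IsOrthogonalFamily v) (hV : HasStrongSum v V) :
    HasStrongSum (fun i ↦ star (v i)) (star V) := by
  obtain ⟨W, hW⟩ := hv.star.exists_hasStrongSum
  exact hV.eq_star hW ▸ hW

theorem star_mul_sum (hv : IsOrthogonalFamily v) (hV : HasStrongSum v V) (i : ι) :
    star (v i) * V = star (v i) * v i :=
  hV.mul_eq_single fun _ hj ↦ hv.star_mul_eq_zero hj.symm

theorem star_sum_mul (hv : IsOrthogonalFamily v) (hV : HasStrongSum v V) (i : ι) :
    star V * v i = star (v i) * v i := by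
  simpa using congrArg star (hv.star_mul_sum hV i)

theorem sum_mul_star (hv : IsOrthogonalFamily v) (hV : HasStrongSum v V) (i : ι) :
    V * star (v i) = v i * star (v i) := by
  simpa using hv.star.star_sum_mul (hv.hasStrongSum_star hV) i

theorem initial_sum_mul_star (hv : IsOrthogonalFamily v) (hV : HasStrongSum v V) (i : ι) :
    star V * V * star (v i) = star (v i) := by
  rw [mul_assoc, hv.sum_mul_star hV, ← mul_assoc, hv.star_sum_mul hV]
  exact (hv.isPartialIsometry i).star_mul_final

theorem hasSum_norm_sq (hv : IsOrthogonalFamily v) (hV : HasStrongSum v V) (ξ : H) :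
    HasSum (fun i ↦ ‖v i ξ‖ ^ 2) (‖V ξ‖ ^ 2) := by
  have hinner (i : ι) : ⟪V ξ, v i ξ⟫ = ⟪v i ξ, v i ξ⟫ := by
    rw [← inner_star_apply_right, ← mul_apply_eq_comp, hv.star_sum_mul hV,
      inner_star_mul_self_apply]
  have h := Complex.hasSum_re ((innerSL ℂ (V ξ)).hasSum (hV ξ))
  have hre (x : H) : (⟪x, x⟫).re = ‖x‖ ^ 2 := inner_self_eq_norm_sq (𝕜 := ℂ) x
  simpa only [innerSL_apply_apply, hinner, hre] using h

theorem isPartialIsometry_sum (hv : IsOrthogonalFamily v) (hV : HasStrongSum v V) :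
    IsPartialIsometry V :=
  hV.eq_mul_self fun i ↦ by
    rw [mul_assoc, hv.star_sum_mul hV, ← mul_assoc, hv.sum_mul_star hV]
    exact hv.isPartialIsometry i

end IsOrthogonalFamily

end StrongSums

section Exhaustion

variable {R : Type*} [Ring R] [StarRing R]

theorem mul_star_eq_zero_of_mul_sub_initial {e v w V : R} (he : IsSelfAdjoint e)
    (hw : IsPartialIsometry w) (hwe : w * e = w) (hVw : star V * w = star w * w)
    (hVw' : V * star w = w * star w) (hv : v * (e - star V * V) = v) : v * star w = 0 := by
  have hew : e * star w = star w := by rw [← he.star_eq, ← star_mul, hwe]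
  rw [← hv, mul_assoc, sub_mul, hew, mul_assoc, hVw', ← mul_assoc, hVw, mul_assoc,
    hw.star_mul_final, sub_self, mul_zero]

/-- Sets of nonzero partial isometries satisfying `P`, with pairwise orthogonal initial and pairwise
orthogonal final projections. -/
structure IsOrthogonalSet (P : R → Prop) (s : Set R) : Prop where
  isPartialIsometry : ∀ v ∈ s, IsPartialIsometry v
  ne_zero : ∀ v ∈ s, v ≠ 0
  prop : ∀ v ∈ s, P v
  pairwise : s.Pairwise fun v w ↦ v * star w = 0 ∧ star v * w = 0

namespace IsOrthogonalSet

variable {P : R → Prop} {s : Set R}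

theorem isOrthogonalFamily (hs : IsOrthogonalSet P s) :
    IsOrthogonalFamily fun i : s ↦ (i : R) where
  isPartialIsometry i := hs.isPartialIsometry i i.2
  mul_star_eq_zero i j hij := (hs.pairwise i.2 j.2 (Subtype.coe_ne_coe.2 hij)).1
  star_mul_eq_zero i j hij := (hs.pairwise i.2 j.2 (Subtype.coe_ne_coe.2 hij)).2

variable (P) in
theorem exists_maximal : ∃ s, Maximal (IsOrthogonalSet P) s := by
  refine zorn_subset {s | IsOrthogonalSet P s} fun C hC hchain ↦
    ⟨⋃₀ C, ⟨?_, ?_, ?_, ?_⟩, fun t ht ↦ Set.subset_sUnion_of_mem ht⟩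
  · rintro v ⟨t, ht, hv⟩
    exact (hC ht).isPartialIsometry v hv
  · rintro v ⟨t, ht, hv⟩
    exact (hC ht).ne_zero v hv
  · rintro v ⟨t, ht, hv⟩
    exact (hC ht).prop v hv
  · exact (Set.pairwise_sUnion hchain.directedOn).2 fun t ht ↦ (hC ht).pairwise

theorem not_orthogonal_of_maximal (hs : Maximal (IsOrthogonalSet P) s) {v : R}
    (hv : IsPartialIsometry v) (hv0 : v ≠ 0) (hvP : P v) :
    ¬ ∀ w ∈ s, v * star w = 0 ∧ star v * w = 0 := by
  intro horth
  have hins : IsOrthogonalSet P (insert v s) := by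
    refine ⟨Set.forall_mem_insert.2 ⟨hv, hs.prop.isPartialIsometry⟩,
      Set.forall_mem_insert.2 ⟨hv0, hs.prop.ne_zero⟩,
      Set.forall_mem_insert.2 ⟨hvP, hs.prop.prop⟩, hs.prop.pairwise.insert fun w hw _ ↦
      ⟨horth w hw, ?_⟩⟩
    exact ⟨by simpa using congrArg star (horth w hw).1, by simpa using congrArg star (horth w hw).2⟩
  have hvs : v ∈ s := hs.le_of_ge hins (Set.subset_insert v s) (Set.mem_insert v s)
  exact hv0 (by rw [← hv, (horth v hvs).1, zero_mul])

end IsOrthogonalSet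

end Exhaustion

section Comparison

variable {H : Type*} [NormedAddCommGroup H] [InnerProductSpace ℂ H] [CompleteSpace H]
  {M : VonNeumannAlgebra H} {e f : H →L[ℂ] H}

/-- Exhaustion: the partial isometries provided by `h` are summed until `e` or `f` is used up. -/
theorem exists_maximal_partialIsometry (heM : e ∈ M) (hfM : f ∈ M) (he : IsStarProjection e)
    (hf : IsStarProjection f) (ξ : H) (c : ℝ)
    (h : ∀ e' ∈ M, ∀ f' ∈ M, IsStarProjection e' → IsStarProjection f' →
      e' * e = e' → f * f' = f' → e' ≠ 0 → f' ≠ 0 →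
      ∃ v ∈ M, IsPartialIsometry v ∧ v ≠ 0 ∧ v * e' = v ∧ f' * v = v ∧
        c * ‖star v ξ‖ ^ 2 ≤ ‖v ξ‖ ^ 2) :
    ∃ V ∈ M, IsPartialIsometry V ∧ V * e = V ∧ f * V = V ∧ c * ‖star V ξ‖ ^ 2 ≤ ‖V ξ‖ ^ 2 ∧
      (star V * V = e ∨ V * star V = f) := by
  obtain ⟨s, hs⟩ := IsOrthogonalSet.exists_maximal fun v : H →L[ℂ] H ↦
    v ∈ M ∧ v * e = v ∧ f * v = v ∧ c * ‖star v ξ‖ ^ 2 ≤ ‖v ξ‖ ^ 2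
  have hfam := hs.prop.isOrthogonalFamily
  obtain ⟨V, hV⟩ := hfam.exists_hasStrongSum
  have hVPI : IsPartialIsometry V := hfam.isPartialIsometry_sum hV
  have hVM : V ∈ M := hV.mem fun i ↦ (hs.prop.prop i i.2).1
  have hVe : V * e = V := hV.mul_eq_self fun i ↦ (hs.prop.prop i i.2).2.1
  have hfV : f * V = V := hV.eq_mul_self fun i ↦ (hs.prop.prop i i.2).2.2.1
  refine ⟨V, hVM, hVPI, hVe, hfV, ?_, ?_⟩
  · exact hasSum_le (fun i : s ↦ (hs.prop.prop i i.2).2.2.2)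
      ((hfam.star.hasSum_norm_sq (hfam.hasStrongSum_star hV) ξ).mul_left c)
      (hfam.hasSum_norm_sq hV ξ)
  by_contra! hcon
  set p := e - star V * V with hp
  set q := f - V * star V with hq
  have hpe : p * e = p := by rw [hp, sub_mul, he.isIdempotentElem.eq, mul_assoc, hVe]
  have hfq : f * q = q := by rw [hq, mul_sub, hf.isIdempotentElem.eq, ← mul_assoc, hfV]
  have hpp : IsStarProjection p :=
    hVPI.isStarProjection_initial.sub_of_mul_eq_left he (by rw [mul_assoc, hVe])
  have hqp : IsStarProjection q :=
    hVPI.isStarProjection_final.sub_of_mul_eq_right hf (by rw [← mul_assoc, hfV])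
  obtain ⟨v, hvM, hvPI, hv0, hvp, hqv, hvξ⟩ := h p (sub_mem heM (mul_mem (star_mem hVM) hVM))
    q (sub_mem hfM (mul_mem hVM (star_mem hVM))) hpp hqp hpe hfq (sub_ne_zero.2 hcon.1.symm)
    (sub_ne_zero.2 hcon.2.symm)
  have hve : v * e = v := by rw [← hvp, mul_assoc, hpe]
  have hfv : f * v = v := by rw [← hqv, ← mul_assoc, hfq]
  refine IsOrthogonalSet.not_orthogonal_of_maximal hs hvPI hv0 ⟨hvM, hve, hfv, hvξ⟩ fun w hw ↦ ?_
  have hwPI := hs.prop.isPartialIsometry w hw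
  obtain ⟨-, hwe, hfw, -⟩ := hs.prop.prop w hw
  have hVw : star V * w = star w * w := hfam.star_sum_mul hV ⟨w, hw⟩
  have hVw' : V * star w = w * star w := hfam.sum_mul_star hV ⟨w, hw⟩
  have hwf : star w * f = star w := by rw [← hf.isSelfAdjoint.star_eq, ← star_mul, hfw]
  have hvq : star v * q = star v := by rw [← hqp.isSelfAdjoint.star_eq, ← star_mul, hqv]
  exact ⟨mul_star_eq_zero_of_mul_sub_initial he.isSelfAdjoint hwPI hwe hVw hVw' hvp,
    by simpa using mul_star_eq_zero_of_mul_sub_initial (v := star v) (w := star w) (V := star V)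
        hf.isSelfAdjoint hwPI.star hwf (by simpa using hVw') (by simpa using hVw)
        (by simpa using hvq)⟩

theorem starProjection_topologicalClosure_mem {S : Submodule ℂ H}
    (hS : ∀ T ∈ M.commutant, ∀ ζ ∈ S, T ζ ∈ S) : S.topologicalClosure.starProjection ∈ M := by
  refine (VonNeumannAlgebra.IsStarProjection.mem_iff isStarProjection_starProjection M).2
    fun T hT ↦ ?_
  rw [Submodule.range_starProjection]
  exact fun ζ hζ ↦ map_mem_closure T.continuous hζ (hS T hT)

theorem exists_mul_mul_ne_zero (hM : M.IsFactor) (heM : e ∈ M) (he0 : e ≠ 0) (hf0 : f ≠ 0) :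
    ∃ x ∈ M, f * x * e ≠ 0 := by
  by_contra! hcon
  -- The projection onto the closure of `M e H` is central.
  set S := Submodule.span ℂ {η | ∃ x ∈ M, ∃ ζ, η = x (e ζ)}
  set p := S.topologicalClosure.starProjection
  have hmaps {T : H →L[ℂ] H} (hT : ∀ x ∈ M, ∀ ζ, T (x (e ζ)) ∈ S) : ∀ ζ ∈ S, T ζ ∈ S := by
    refine fun ζ hζ ↦ Submodule.span_le (p := S.comap (T : H →ₗ[ℂ] H)) |>.2 ?_ hζ
    rintro _ ⟨x, hx, ζ, rfl⟩
    exact hT x hx ζ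
  have hpM : p ∈ M := starProjection_topologicalClosure_mem fun T hT ↦ hmaps fun x hx ζ ↦ by
    refine Submodule.subset_span ⟨x, hx, T ζ, ?_⟩
    exact DFunLike.congr_fun (commute_of_mem_commutant hT (mul_mem hx heM)).eq ζ
  have hpM' : p ∈ M.commutant := starProjection_topologicalClosure_mem fun T hT ↦
    hmaps fun x hx ζ ↦ by
      rw [VonNeumannAlgebra.commutant_commutant] at hT
      exact Submodule.subset_span ⟨T * x, mul_mem hT hx, ζ, rfl⟩
  obtain ⟨c, hc⟩ := hM.center p hpM hpM'
  have hpe : p * e = e := by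
    ext ζ
    refine Submodule.starProjection_eq_self_iff.2 (S.le_topologicalClosure ?_)
    exact Submodule.subset_span ⟨1, one_mem M, ζ, rfl⟩
  have hfp : f * p = 0 := by
    have hker : S.topologicalClosure ≤ f.ker := by
      refine Submodule.topologicalClosure_minimal _ (Submodule.span_le.2 ?_) f.isClosed_ker
      rintro _ ⟨x, hx, ζ, rfl⟩
      exact DFunLike.congr_fun (hcon x hx) ζ
    ext ζ
    exact hker (Submodule.starProjection_apply_mem _ ζ)
  rw [hc, smul_one_mul] at hpe
  rw [hc, mul_smul_one, smul_eq_zero_iff_left hf0] at hfp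
  exact he0 (by rw [← hpe, hfp, zero_smul])

theorem exists_ne_zero_partialIsometry (hM : M.IsFactor) (heM : e ∈ M) (hfM : f ∈ M)
    (he : IsStarProjection e) (hf : IsStarProjection f) (he0 : e ≠ 0) (hf0 : f ≠ 0) :
    ∃ v ∈ M, IsPartialIsometry v ∧ v ≠ 0 ∧ v * e = v ∧ f * v = v := by
  obtain ⟨x, hx, hfxe⟩ := exists_mul_mul_ne_zero hM heM he0 hf0
  obtain ⟨v, hvM, hv⟩ := exists_isSupportIsometry_mem (mul_mem (mul_mem hfM hx) heM)
  refine ⟨v, hvM, hv.isPartialIsometry, ?_, hv.mul_eq_self ?_, hv.eq_mul_self hf.isSelfAdjoint ?_⟩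
  · rintro rfl
    exact hfxe (by rw [← hv.mul_initial, mul_zero, mul_zero])
  · rw [mul_assoc, he.isIdempotentElem.eq]
  · rw [← mul_assoc, ← mul_assoc, hf.isIdempotentElem.eq]

theorem mul_star_eq_of_isFinite (hM : M.IsFinite) {V : H →L[ℂ] H} (hVM : V ∈ M)
    (hf : IsStarProjection f) (hV : star V * V = f) (hfV : f * V = V) : V * star V = f := by
  have hPI : IsPartialIsometry V := .of_isStarProjection_star_mul_self (hV ▸ hf)
  have hVf : V * f = V := hV ▸ hPI.mul_initial
  have hsVf : star V * f = star V := by rw [← hf.isSelfAdjoint.star_eq, ← star_mul, hfV]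
  have hfsV : f * star V = star V := by rw [← hf.isSelfAdjoint.star_eq, ← star_mul, hVf]
  -- Extend `V` by the identity on the complement of `f`.
  set W := V + (1 - f) with hW
  have hWM : W ∈ M := add_mem hVM (sub_mem (one_mem M) (hV ▸ mul_mem (star_mem hVM) hVM))
  have hWW : star W * W = 1 := by
    rw [hW, star_add, hf.one_sub.isSelfAdjoint.star_eq]
    simp only [mul_add, add_mul, mul_sub, sub_mul, mul_one, one_mul, hV, hfV, hsVf,
      hf.isIdempotentElem.eq]
    abel
  have hWW' : W * star W = V * star V + (1 - f) := by
    rw [hW, star_add, hf.one_sub.isSelfAdjoint.star_eq]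
    simp only [mul_add, add_mul, mul_sub, sub_mul, mul_one, one_mul, hVf, hfsV,
      hf.isIdempotentElem.eq]
    abel
  have hWPI : IsPartialIsometry W := .of_isStarProjection_star_mul_self (hWW ▸ .one _)
  have hfin := hM _ (mul_mem hWM (star_mem hWM)) hWPI.isStarProjection_final ⟨W, hWM, hWW, rfl⟩
  rw [hWW', add_sub_left_comm, add_eq_left, sub_eq_zero] at hfin
  exact hfin

end Comparison

section AlmostTracial

variable {H : Type*} [NormedAddCommGroup H] [InnerProductSpace ℂ H] [CompleteSpace H]
  {M : VonNeumannAlgebra H} {u v w : H →L[ℂ] H} {ξ : H}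

local notation "⟪" x ", " y "⟫" => inner ℂ x y

/-- `v` maps the initial space of `u` into its final space, and vanishes off that initial space. -/
def SupportedUnder (v u : H →L[ℂ] H) : Prop := v * (star u * u) = v ∧ u * star u * v = v

theorem IsPartialIsometry.supportedUnder_self (hu : IsPartialIsometry u) : SupportedUnder u u :=
  ⟨hu.mul_initial, hu⟩

namespace SupportedUnder

theorem trans (h : SupportedUnder v w) (h' : SupportedUnder w u) : SupportedUnder v u := by
  have hinitial : star w * w * (star u * u) = star w * w := by rw [mul_assoc, h'.1]
  have hfinal : u * star u * (w * star w) = w * star w := by rw [← mul_assoc, h'.2]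
  exact ⟨by rw [← h.1, mul_assoc, hinitial], by rw [← h.2, ← mul_assoc, hfinal]⟩

protected theorem star (h : SupportedUnder v u) : SupportedUnder (star v) (star u) :=
  ⟨by simpa [mul_assoc] using congrArg star h.2, by simpa [mul_assoc] using congrArg star h.1⟩

end SupportedUnder

theorem mul_star_eq_of_star_mul_eq (hM : M.IsFinite) (hvM : v ∈ M) (huM : u ∈ M)
    (hu : IsPartialIsometry u) (hv : star v * v = star u * u) (huv : u * star u * v = v) :
    v * star v = u * star u := by
  have hPI : IsPartialIsometry v :=
    .of_isStarProjection_star_mul_self (hv ▸ hu.isStarProjection_initial)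
  have hinitial : star (v * star u) * (v * star u) = u * star u := by
    rw [star_mul, star_star]
    calc u * star v * (v * star u) = u * (star v * v) * star u := by simp only [mul_assoc]
      _ = u * star u := by rw [hv, hu.mul_initial]
  have hfinal := mul_star_eq_of_isFinite hM (mul_mem hvM (star_mem huM)) hu.isStarProjection_final
    hinitial (by rw [← mul_assoc, huv])
  rw [← hfinal, star_mul, star_star]
  calc v * star v = v * (star v * v) * star v := by rw [hPI.mul_initial]
    _ = v * star u * (u * star v) := by rw [hv]; simp only [mul_assoc]

/-- The vector functional `ω x = ⟪ξ, x ξ⟫` satisfies `ω (v⋆ v) ≤ c * ω (v v⋆)` for every partial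
isometry `v` of `M` supported under `u`. -/
def VectorDominated (M : VonNeumannAlgebra H) (ξ : H) (c : ℝ) (u : H →L[ℂ] H) : Prop :=
  ∀ v ∈ M, IsPartialIsometry v → SupportedUnder v u → ‖v ξ‖ ^ 2 ≤ c * ‖star v ξ‖ ^ 2

theorem VectorDominated.mono {c : ℝ} (h : VectorDominated M ξ c u) (hwu : SupportedUnder w u) :
    VectorDominated M ξ c w :=
  fun v hvM hv hvw ↦ h v hvM hv (hvw.trans hwu)

/-- If no nonzero partial isometry under `u` dominated `ξ`, then violating partial isometries could
be summed to one equivalent to `u`, which would make `u` violating. -/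
theorem exists_vectorDominated (hM : M.IsFactor) (hfin : M.IsFinite) (huM : u ∈ M)
    (hu : IsPartialIsometry u) {c : ℝ} (h : ‖u ξ‖ ^ 2 < c * ‖star u ξ‖ ^ 2) :
    ∃ w ∈ M, IsPartialIsometry w ∧ w ≠ 0 ∧ SupportedUnder w u ∧ VectorDominated M ξ c w := by
  by_contra! hcon
  obtain ⟨V, hVM, -, hVe, hfV, hVξ, hmax⟩ := exists_maximal_partialIsometry (e := star u * u)
    (f := u * star u) (mul_mem (star_mem huM) huM) (mul_mem huM (star_mem huM))
    hu.isStarProjection_initial hu.isStarProjection_final ξ c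
    (fun e' heM f' hfM he hf hee hff he0 hf0 ↦ by
      obtain ⟨w, hwM, hw, hw0, hwe, hfw⟩ := exists_ne_zero_partialIsometry hM heM hfM he hf he0 hf0
      have hwu : SupportedUnder w u :=
        ⟨by rw [← hwe, mul_assoc, hee], by rw [← hfw, ← mul_assoc, hff]⟩
      obtain ⟨v, hvM, hv, ⟨hvw, hwv⟩, hvξ⟩ : ∃ v ∈ M, IsPartialIsometry v ∧ SupportedUnder v w ∧
          c * ‖star v ξ‖ ^ 2 < ‖v ξ‖ ^ 2 := by
        simpa [VectorDominated] using hcon w hwM hw hw0 hwu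
      refine ⟨v, hvM, hv, ?_, ?_, ?_, hvξ.le⟩
      · rintro rfl
        simp at hvξ
      · rw [← hvw, mul_assoc, mul_assoc, hwe]
      · rw [← hwv, ← mul_assoc, ← mul_assoc, hfw])
  have hequiv : star V * V = star u * u ∧ V * star V = u * star u := by
    rcases hmax with hinitial | hfinal
    · exact ⟨hinitial, mul_star_eq_of_star_mul_eq hfin hVM huM hu hinitial hfV⟩
    · refine ⟨?_, hfinal⟩
      simpa using mul_star_eq_of_star_mul_eq (v := star V) (u := star u) hfin (star_mem hVM)
        (star_mem huM) hu.star (by simpa using hfinal)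
        (by simpa [mul_assoc] using congrArg star hVe)
  have hstar : ‖star V ξ‖ = ‖star u ξ‖ :=
    norm_apply_eq_of_star_mul_self_eq (by simpa using hequiv.2) ξ
  rw [norm_apply_eq_of_star_mul_self_eq hequiv.1 ξ, hstar] at hVξ
  exact h.not_ge hVξ

theorem exists_vectorDominated_star (hM : M.IsFactor) (hfin : M.IsFinite) (huM : u ∈ M)
    (hu : IsPartialIsometry u) {c : ℝ} (h : ‖star u ξ‖ ^ 2 < c * ‖u ξ‖ ^ 2) :
    ∃ w ∈ M, IsPartialIsometry w ∧ w ≠ 0 ∧ SupportedUnder w u ∧ VectorDominated M ξ c (star w) := by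
  obtain ⟨w, hwM, hw, hw0, hwu, hdom⟩ :=
    exists_vectorDominated hM hfin (star_mem huM) hu.star (ξ := ξ) (by simpa using h)
  exact ⟨star w, star_mem hwM, hw.star, star_ne_zero.2 hw0, by simpa using hwu.star, by simpa⟩

/-- Bounds in both directions under `w` transfer to the corner of `star w * w`: for `v` in that
corner, apply them to `w v` and to `w (v v⋆)`, which have the same final projection. -/
theorem VectorDominated.norm_sq_apply_le (hwM : w ∈ M) (hw : IsPartialIsometry w) {a b : ℝ}
    (ha : 0 ≤ a) (hwa : VectorDominated M ξ a w) (hwb : VectorDominated M ξ b (star w))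
    (hvM : v ∈ M) (hv : IsPartialIsometry v) (hvw : v * (star w * w) = v)
    (hwv : star w * w * v = v) : ‖v ξ‖ ^ 2 ≤ a * (b * ‖star v ξ‖ ^ 2) := by
  have hp := hv.isStarProjection_final
  have hwp : star w * w * (v * star v) = v * star v := by rw [← mul_assoc, hwv]
  have hvw' : star v * (star w * w) = star v := by simpa [mul_assoc] using congrArg star hwv
  have hPI : IsPartialIsometry (w * v) := by
    rw [IsPartialIsometry, star_mul]
    calc w * v * (star v * star w) * (w * v) = w * (v * star v) * (star w * w * v) := by
          simp only [mul_assoc]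
      _ = w * v := by rw [hwv, mul_assoc, hv]
  have hinitial : ‖(w * v) ξ‖ = ‖v ξ‖ := norm_apply_eq_of_star_mul_self_eq (by
    rw [star_mul, mul_assoc, ← mul_assoc (star w), hwv]) ξ
  have hfinal : ‖star (w * v) ξ‖ = ‖star (w * (v * star v)) ξ‖ :=
    norm_apply_eq_of_star_mul_self_eq (by
      rw [star_star, star_star, star_mul, star_mul, hp.isSelfAdjoint.star_eq]
      calc w * v * (star v * star w) = w * (v * star v) * star w := by simp only [mul_assoc]
        _ = w * ((v * star v) * (v * star v)) * star w := by rw [hp.isIdempotentElem.eq]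
        _ = w * (v * star v) * (v * star v * star w) := by simp only [mul_assoc]) ξ
  have hprojection : ‖(w * (v * star v)) ξ‖ = ‖star v ξ‖ := norm_apply_eq_of_star_mul_self_eq (by
    rw [star_mul, star_star, mul_assoc, ← mul_assoc (star w), hwp, hp.isSelfAdjoint.star_eq,
      hp.isIdempotentElem.eq]) ξ
  have h₁ := hwa _ (mul_mem hwM hvM) hPI ⟨by rw [mul_assoc, hvw], by rw [← mul_assoc, hw]⟩
  have h₂ := hwb (star (w * (v * star v)))
    (star_mem (mul_mem hwM (mul_mem hvM (star_mem hvM))))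
    (IsPartialIsometry.mul_projection hp hwp).star
    (SupportedUnder.star ⟨by simp only [mul_assoc, hvw'], by rw [← mul_assoc, hw]⟩)
  rw [star_star, hprojection] at h₂
  rw [hinitial, hfinal] at h₁
  exact h₁.trans (by gcongr)

/-- The constants `c ≥ 0` for which `ξ` is `c`-dominated under some nonzero partial isometry
supported under `u`. -/
def dominationConstants (M : VonNeumannAlgebra H) (ξ : H) (u : H →L[ℂ] H) : Set ℝ :=
  {c | 0 ≤ c ∧ ∃ w ∈ M, IsPartialIsometry w ∧ w ≠ 0 ∧ SupportedUnder w u ∧ VectorDominated M ξ c w}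

theorem dominationConstants_nonempty (hM : M.IsFactor) (hfin : M.IsFinite) (huM : u ∈ M)
    (hu : IsPartialIsometry u) (hξ : star u ξ ≠ 0) : (dominationConstants M ξ u).Nonempty := by
  have hpos : 0 < ‖star u ξ‖ ^ 2 := by positivity
  have hc : 0 ≤ ‖u ξ‖ ^ 2 / ‖star u ξ‖ ^ 2 + 1 := by positivity
  refine ⟨_, hc, exists_vectorDominated hM hfin huM hu ?_⟩
  rw [add_mul, div_mul_cancel₀ _ hpos.ne']
  linarith

theorem inv_le_of_mem_dominationConstants {b c : ℝ} (hb : 0 < b)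
    (hdom : VectorDominated M ξ b (star u))
    (hξ : ∀ v ∈ M, v ≠ 0 → SupportedUnder v u → v ξ ≠ 0) (hc : c ∈ dominationConstants M ξ u) :
    b⁻¹ ≤ c := by
  obtain ⟨hc0, w, hwM, hw, hw0, hwu, hwdom⟩ := hc
  have hpos : 0 < ‖w ξ‖ ^ 2 := by have := hξ w hwM hw0 hwu; positivity
  have h₁ := hwdom w hwM hw hw.supportedUnder_self
  have h₂ : ‖star w ξ‖ ^ 2 ≤ b * ‖w ξ‖ ^ 2 := by
    simpa using hdom (star w) (star_mem hwM) hw.star hwu.star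
  rw [inv_le_iff_one_le_mul₀' hb]
  refine le_of_mul_le_mul_right ?_ hpos
  calc 1 * ‖w ξ‖ ^ 2 ≤ c * (b * ‖w ξ‖ ^ 2) := by
        rw [one_mul]
        exact h₁.trans (by gcongr)
    _ = b * c * ‖w ξ‖ ^ 2 := by ring

/-- A nearly optimal domination constant is also nearly optimal in the reverse direction. -/
theorem exists_vectorDominated_both (hM : M.IsFactor) (hfin : M.IsFinite) {b r : ℝ} (hb : 0 < b)
    (hdom : VectorDominated M ξ b (star u))
    (hξ : ∀ v ∈ M, v ≠ 0 → SupportedUnder v u → v ξ ≠ 0)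
    (hne : (dominationConstants M ξ u).Nonempty) (hr : 1 < r) :
    ∃ w ∈ M, IsPartialIsometry w ∧ w ≠ 0 ∧ SupportedUnder w u ∧
      ∃ c > 0, VectorDominated M ξ (c * r) w ∧ VectorDominated M ξ (r / c) (star w) := by
  set c := sInf (dominationConstants M ξ u)
  have hlow : b⁻¹ ∈ lowerBounds (dominationConstants M ξ u) :=
    fun _ ↦ inv_le_of_mem_dominationConstants hb hdom hξ
  have hc : 0 < c := (inv_pos.2 hb).trans_le (le_csInf hne hlow)
  obtain ⟨c', ⟨-, w, hwM, hw, hw0, hwu, hwdom⟩, hc'⟩ :=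
    exists_lt_of_csInf_lt hne (lt_mul_of_one_lt_right hc hr)
  obtain ⟨w', hw'M, hw', hw'w, hlt⟩ : ∃ w' ∈ M, IsPartialIsometry w' ∧ SupportedUnder w' w ∧
      c / r * ‖star w' ξ‖ ^ 2 < ‖w' ξ‖ ^ 2 := by
    by_contra! hcon
    exact notMem_of_lt_csInf (div_lt_self hc hr) ⟨_, hlow⟩
      ⟨by positivity, w, hwM, hw, hw0, hwu, hcon⟩
  have hlt' : ‖star w' ξ‖ ^ 2 < r / c * ‖w' ξ‖ ^ 2 := by
    rw [div_mul_eq_mul_div, lt_div_iff₀ hc]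
    rw [div_mul_eq_mul_div, div_lt_iff₀ (by positivity)] at hlt
    linarith
  obtain ⟨z, hzM, hz, hz0, hzw', hzdom⟩ := exists_vectorDominated_star hM hfin hw'M hw' hlt'
  have hzw := hzw'.trans hw'w
  refine ⟨z, hzM, hz, hz0, hzw.trans hwu, c, hc, fun v hvM hv hvz ↦ ?_, hzdom⟩
  exact (hwdom.mono hzw v hvM hv hvz).trans (by gcongr)

theorem exists_support_projection (M : VonNeumannAlgebra H) (ξ : H) :
    ∃ s ∈ M, IsStarProjection s ∧ s ξ = ξ ∧ ∀ v ∈ M, v ξ = 0 → v * s = 0 := by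
  set S := Submodule.span ℂ {η | ∃ T ∈ M.commutant, η = T ξ}
  refine ⟨S.topologicalClosure.starProjection, starProjection_topologicalClosure_mem ?_,
    isStarProjection_starProjection, ?_, fun v hv hvξ ↦ ?_⟩
  · refine fun T hT ζ hζ ↦ Submodule.span_le (p := S.comap (T : H →ₗ[ℂ] H)) |>.2 ?_ hζ
    rintro _ ⟨x, hx, rfl⟩
    exact Submodule.subset_span ⟨T * x, mul_mem hT hx, rfl⟩
  · refine Submodule.starProjection_eq_self_iff.2 (S.le_topologicalClosure ?_)
    exact Submodule.subset_span ⟨1, one_mem _, rfl⟩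
  · have hker : S.topologicalClosure ≤ v.ker := by
      refine Submodule.topologicalClosure_minimal _ (Submodule.span_le.2 ?_) v.isClosed_ker
      rintro _ ⟨T, hT, rfl⟩
      exact (DFunLike.congr_fun (commute_of_mem_commutant hT hv).eq ξ).symm.trans
        (by rw [mul_apply_eq_comp, hvξ, map_zero])
    ext ζ
    exact hker (Submodule.starProjection_apply_mem _ ζ)

theorem exists_projection_almost_tracial (hM : M.IsFactor) (hfin : M.IsFinite) (hξ : ξ ≠ 0) {κ : ℝ}
    (hκ : 1 < κ) :
    ∃ g ∈ M, IsStarProjection g ∧ g ξ ≠ 0 ∧ ∀ v ∈ M, IsPartialIsometry v → v * g = v → g * v = v →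
      ‖v ξ‖ ^ 2 ≤ κ * ‖star v ξ‖ ^ 2 := by
  obtain ⟨s, hsM, hs, hsξ, hsv⟩ := exists_support_projection M ξ
  have hss : star s * s = s := by rw [hs.isSelfAdjoint.star_eq, hs.isIdempotentElem.eq]
  have hne {v : H →L[ℂ] H} (hvM : v ∈ M) (hv0 : v ≠ 0) (hvs : SupportedUnder v s) : v ξ ≠ 0 :=
    fun h ↦ hv0 (by rw [← hvs.1, hss, hsv v hvM h])
  obtain ⟨u, huM, hu, hu0, hus, hudom⟩ := exists_vectorDominated_star hM hfin hsM
    (.of_isStarProjection hs) (ξ := ξ) (c := 2) (by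
      have : 0 < ‖ξ‖ ^ 2 := by positivity
      rw [hs.isSelfAdjoint.star_eq, hsξ]
      linarith)
  have huξ : star u ξ ≠ 0 := hne (star_mem huM) (star_ne_zero.2 hu0)
    (by simpa [hs.isSelfAdjoint.star_eq] using hus.star)
  obtain ⟨w, hwM, hw, hw0, hwu, c, hc, hwdom, hwdom'⟩ := exists_vectorDominated_both hM hfin
    two_pos hudom (fun v hvM hv0 hvu ↦ hne hvM hv0 (hvu.trans hus))
    (dominationConstants_nonempty hM hfin huM hu huξ)
    (show 1 < √κ from Real.lt_sqrt_of_sq_lt (by simpa using hκ))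
  refine ⟨star w * w, mul_mem (star_mem hwM) hwM, hw.isStarProjection_initial,
    star_mul_self_apply_eq_zero_iff.not.2 (hne hwM hw0 (hwu.trans hus)),
    fun v hvM hv hvw hwv ↦ (hwdom.norm_sq_apply_le hwM hw (by positivity) hwdom' hvM hv hvw
      hwv).trans_eq ?_⟩
  rw [← mul_assoc, mul_assoc c, mul_div_assoc', Real.mul_self_sqrt (by positivity),
    mul_div_cancel₀ _ hc.ne']

theorem IsPartialIsometry.norm_apply_le (hv : IsPartialIsometry v) (ξ : H) : ‖v ξ‖ ≤ ‖ξ‖ := by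
  have hp := hv.isStarProjection_initial
  rw [norm_apply_eq_of_star_mul_self_eq (b := star v * v)
    (by rw [hp.isSelfAdjoint.star_eq, hp.isIdempotentElem.eq])]
  exact ((star v * v).le_of_opNorm_le hp.norm_le ξ).trans (one_mul _).le

theorem re_inner_smul_sum (s : Finset ℕ) (c : ℝ) (v : ℕ → H →L[ℂ] H) (ξ : H) :
    (⟪ξ, (c • ∑ k ∈ s, star (v k) * v k) ξ⟫).re = c * ∑ k ∈ s, ‖v k ξ‖ ^ 2 := by
  rw [smul_apply, inner_smul_right_eq_smul, Complex.smul_re, sum_apply, inner_sum, Complex.re_sum,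
    smul_eq_mul]
  simp_rw [re_inner_star_mul_self]

omit [CompleteSpace H] in
theorem re_inner_mono {S T : H →L[ℂ] H} (h : S ≤ T) (ξ : H) : (⟪ξ, S ξ⟫).re ≤ (⟪ξ, T ξ⟫).re := by
  have hnonneg : 0 ≤ (⟪ξ, _⟫).re :=
    ((ContinuousLinearMap.le_def _ _).1 h).re_inner_nonneg_right ξ
  rwa [sub_apply, inner_sub_right, Complex.sub_re, sub_nonneg] at hnonneg

theorem norm_sq_apply_le_of_star_mul_self_le {x : H →L[ℂ] H} {v : ℕ → H →L[ℂ] H} {n : ℕ}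
    (hv : IsPartialIsometry (v 0))
    (h : star x * x ≤ (n : ℝ)⁻¹ • ∑ k ∈ Finset.range n, star (v k) * v k) (ξ : H) :
    ‖x ξ‖ ^ 2 ≤ (n : ℝ)⁻¹ * (‖ξ‖ ^ 2 + ∑ k ∈ Finset.range n, ‖v (k + 1) ξ‖ ^ 2) := by
  have hle : ‖x ξ‖ ^ 2 ≤ (n : ℝ)⁻¹ * ∑ k ∈ Finset.range n, ‖v k ξ‖ ^ 2 := by
    simpa only [re_inner_star_mul_self, re_inner_smul_sum] using re_inner_mono h ξ
  have hzero : ‖v 0 ξ‖ ^ 2 ≤ ‖ξ‖ ^ 2 := by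
    gcongr
    exact hv.norm_apply_le ξ
  have hshift := Finset.sum_range_succ (fun k ↦ ‖v k ξ‖ ^ 2) n
  rw [Finset.sum_range_succ'] at hshift
  refine hle.trans ?_
  gcongr
  linarith [sq_nonneg ‖v n ξ‖]

section Corner

variable {g x : H →L[ℂ] H} {κ : ℝ}

theorem norm_sq_apply_le_add_of_layers (hg : IsStarProjection g) (hκ : 0 ≤ κ)
    (h : ∀ v ∈ M, IsPartialIsometry v → v * g = v → g * v = v → ‖v ξ‖ ^ 2 ≤ κ * ‖star v ξ‖ ^ 2)
    (hx : x ∈ M) (hx1 : ‖x‖ ≤ 1) (hxg : x * g = x) (hgx : g * x = x) {n : ℕ} (hn : 0 < n) :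
    ‖x ξ‖ ^ 2 ≤ κ * ‖star x ξ‖ ^ 2 + ‖ξ‖ ^ 2 * (n : ℝ)⁻¹ := by
  obtain ⟨v, hv, hle, -, hle'⟩ := exists_layers hx hx1 hg.isSelfAdjoint hxg hgx hn
  have hlower : (n : ℝ)⁻¹ * ∑ k ∈ Finset.range n, ‖star (v (k + 1)) ξ‖ ^ 2 ≤ ‖star x ξ‖ ^ 2 := by
    have hsum := re_inner_smul_sum (Finset.range n) (n : ℝ)⁻¹ (fun k ↦ star (v (k + 1))) ξ
    have hstar := re_inner_star_mul_self (star x) ξ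
    simp only [star_star] at hsum hstar
    simpa only [hsum, hstar] using re_inner_mono hle' ξ
  have hterm : ∑ k ∈ Finset.range n, ‖v (k + 1) ξ‖ ^ 2 ≤
      κ * ∑ k ∈ Finset.range n, ‖star (v (k + 1)) ξ‖ ^ 2 := by
    rw [Finset.mul_sum]
    exact Finset.sum_le_sum fun k _ ↦
      h _ (hv (k + 1)).1 (hv (k + 1)).2.1 (hv (k + 1)).2.2.1 (hv (k + 1)).2.2.2
  calc ‖x ξ‖ ^ 2
      ≤ (n : ℝ)⁻¹ * (‖ξ‖ ^ 2 + κ * ∑ k ∈ Finset.range n, ‖star (v (k + 1)) ξ‖ ^ 2) :=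
        (norm_sq_apply_le_of_star_mul_self_le (hv 0).2.1 hle ξ).trans (by gcongr)
    _ = κ * ((n : ℝ)⁻¹ * ∑ k ∈ Finset.range n, ‖star (v (k + 1)) ξ‖ ^ 2) + ‖ξ‖ ^ 2 * (n : ℝ)⁻¹ := by
        ring
    _ ≤ κ * ‖star x ξ‖ ^ 2 + ‖ξ‖ ^ 2 * (n : ℝ)⁻¹ := by gcongr

theorem norm_sq_apply_le_of_forall_partialIsometry (hg : IsStarProjection g) (hκ : 0 ≤ κ)
    (h : ∀ v ∈ M, IsPartialIsometry v → v * g = v → g * v = v → ‖v ξ‖ ^ 2 ≤ κ * ‖star v ξ‖ ^ 2)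
    (hx : x ∈ M) (hxg : x * g = x) (hgx : g * x = x) : ‖x ξ‖ ^ 2 ≤ κ * ‖star x ξ‖ ^ 2 := by
  wlog hx1 : ‖x‖ ≤ 1 generalizing x
  · have hx0 : 0 < ‖x‖ := by linarith
    have hscaled := this (x := ((‖x‖⁻¹ : ℝ) : ℂ) • x) (M.toStarSubalgebra.smul_mem hx _)
      (by rw [smul_mul_assoc, hxg])
      (by rw [mul_smul_comm, hgx]) (by
        rw [norm_smul, Complex.norm_real, norm_inv, norm_norm, inv_mul_cancel₀ hx0.ne'])
    rw [star_smul, smul_apply, smul_apply, norm_smul, norm_smul, norm_star, mul_pow, mul_pow,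
      mul_left_comm, Complex.norm_real, norm_inv, norm_norm] at hscaled
    exact le_of_mul_le_mul_left hscaled (by positivity)
  have hlim : Filter.Tendsto (fun n : ℕ ↦ κ * ‖star x ξ‖ ^ 2 + ‖ξ‖ ^ 2 * (n : ℝ)⁻¹) Filter.atTop
      (nhds (κ * ‖star x ξ‖ ^ 2)) := by
    simpa using (tendsto_inv_atTop_nhds_zero_nat.const_mul (‖ξ‖ ^ 2)).const_add
      (κ * ‖star x ξ‖ ^ 2)
  refine ge_of_tendsto hlim (Filter.eventually_atTop.2 ⟨1, fun n hn ↦ ?_⟩)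
  exact norm_sq_apply_le_add_of_layers hg hκ h hx hx1 hxg hgx hn

end Corner

end AlmostTracial

section FiniteFactor

variable {H : Type*} [NormedAddCommGroup H] [InnerProductSpace ℂ H] [CompleteSpace H]
  {M : VonNeumannAlgebra H} {g : H →L[ℂ] H}

local notation "⟪" x ", " y "⟫" => inner ℂ x y

theorem IsPartialIsometry.of_isStarProjection_mul_star_self {w : H →L[ℂ] H}
    (h : IsStarProjection (w * star w)) : IsPartialIsometry w := by
  have hstar : IsPartialIsometry (star w) :=
    .of_isStarProjection_star_mul_self (by rwa [star_star])
  simpa using hstar.star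

/-- The shift `∑ w (n + 1)⋆ w n` would be a partial isometry from the sum of the initial projections
onto the same sum without its first term. -/
theorem eq_zero_of_pairwise_orthogonal (hM : M.IsFinite) (hg : IsStarProjection g)
    {w : ℕ → H →L[ℂ] H} (hwM : ∀ n, w n ∈ M) (hwg : ∀ n, w n * star (w n) = g)
    (horth : Pairwise fun m n ↦ w m * star (w n) = 0) : g = 0 := by
  have hPI (n) : IsPartialIsometry (w n) := .of_isStarProjection_mul_star_self (by rwa [hwg])
  have hgw (n) : g * w n = w n := by
    rw [← hwg n]
    exact hPI n
  set u : ℕ → H →L[ℂ] H := fun n ↦ star (w (n + 1)) * w n with hu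
  have hsu (n) : star (u n) = star (w n) * w (n + 1) := by simp only [hu, star_mul, star_star]
  have huu (n) : star (u n) * u n = star (w n) * w n := by
    rw [hsu, mul_assoc, ← mul_assoc (w (n + 1)), hwg, hgw]
  have hfam : IsOrthogonalFamily u :=
    { isPartialIsometry n :=
        .of_isStarProjection_star_mul_self (by rw [huu]; exact (hPI n).isStarProjection_initial)
      mul_star_eq_zero i j hij := by
        beta_reduce
        rw [hsu, mul_assoc, ← mul_assoc (w i), horth hij, zero_mul, mul_zero]
      star_mul_eq_zero i j hij := by
        beta_reduce
        rw [hsu, mul_assoc, ← mul_assoc (w (i + 1)), horth (by omega), zero_mul, mul_zero] }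
  obtain ⟨U, hU⟩ := hfam.exists_hasStrongSum
  have hQ (n) : star U * U * star (w n) = star (w n) := by
    have hw : star (w n) = star (u n) * star (w (n + 1)) := by
      rw [hsu, mul_assoc, hwg, ← hg.isSelfAdjoint.star_eq, ← star_mul, hgw]
    rw [hw, ← mul_assoc, hfam.initial_sum_mul_star hU]
  have hQU : star U * U * U = U := hU.eq_mul_self fun n ↦ by rw [hu, ← mul_assoc, hQ]
  have hfinal : U * star U = star U * U :=
    mul_star_eq_of_isFinite hM (hU.mem fun n ↦ mul_mem (star_mem (hwM _)) (hwM n))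
      (hfam.isPartialIsometry_sum hU).isStarProjection_initial rfl hQU
  have hwU : w 0 * U = 0 := by
    rw [hU.mul_eq_mul (S := 0) fun n ↦ by
      rw [hu, ← mul_assoc, horth (by omega), zero_mul, mul_zero], mul_zero]
  rw [← hwg 0, ← hQ 0, ← hfinal, ← mul_assoc, ← mul_assoc, hwU, zero_mul, zero_mul]

/-- Sets of partial isometries of `M` with pairwise orthogonal initial projections and common final
projection `g`. -/
structure IsEquivalentSet (M : VonNeumannAlgebra H) (g : H →L[ℂ] H) (s : Set (H →L[ℂ] H)) :
    Prop where
  mem : ∀ w ∈ s, w ∈ M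
  mul_star_eq : ∀ w ∈ s, w * star w = g
  pairwise : s.Pairwise fun v w ↦ v * star w = 0

namespace IsEquivalentSet

variable {s : Set (H →L[ℂ] H)}

theorem finite (hs : IsEquivalentSet M g s) (hM : M.IsFinite) (hg : IsStarProjection g)
    (hg0 : g ≠ 0) : s.Finite := by
  by_contra hinf
  let e := Set.Infinite.natEmbedding s hinf
  exact hg0 <| eq_zero_of_pairwise_orthogonal hM hg (fun n ↦ hs.mem _ (e n).2)
    (fun n ↦ hs.mul_star_eq _ (e n).2) fun m n hmn ↦
      hs.pairwise (e m).2 (e n).2 (Subtype.coe_ne_coe.2 (e.injective.ne hmn))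

theorem isPartialIsometry (hs : IsEquivalentSet M g s) (hg : IsStarProjection g) {w : H →L[ℂ] H}
    (hw : w ∈ s) : IsPartialIsometry w :=
  .of_isStarProjection_mul_star_self (by rwa [hs.mul_star_eq w hw])

variable (M g) in
theorem exists_maximal : ∃ s, Maximal (IsEquivalentSet M g) s := by
  refine zorn_subset {s | IsEquivalentSet M g s} fun C hC hchain ↦
    ⟨⋃₀ C, ⟨?_, ?_, ?_⟩, fun t ht ↦ Set.subset_sUnion_of_mem ht⟩
  · rintro v ⟨t, ht, hv⟩
    exact (hC ht).mem v hv
  · rintro v ⟨t, ht, hv⟩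
    exact (hC ht).mul_star_eq v hv
  · exact (Set.pairwise_sUnion hchain.directedOn).2 fun t ht ↦ (hC ht).pairwise

theorem eq_zero_of_maximal (hs : Maximal (IsEquivalentSet M g) s) {v : H →L[ℂ] H} (hvM : v ∈ M)
    (hvg : v * star v = g) (horth : ∀ w ∈ s, v * star w = 0) : g = 0 := by
  have hins : IsEquivalentSet M g (insert v s) :=
    ⟨Set.forall_mem_insert.2 ⟨hvM, hs.prop.mem⟩, Set.forall_mem_insert.2 ⟨hvg, hs.prop.mul_star_eq⟩,
      hs.prop.pairwise.insert fun w hw _ ↦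
        ⟨horth w hw, by simpa using congrArg star (horth w hw)⟩⟩
  rw [← hvg, horth v (hs.le_of_ge hins (Set.subset_insert v s) (Set.mem_insert v s))]

variable [Fintype s]

theorem isStarProjection_sum_initial (hs : IsEquivalentSet M g s) (hg : IsStarProjection g) :
    IsStarProjection (∑ w : s, star (w : H →L[ℂ] H) * w) := by
  refine isStarProjection_sum (fun w ↦ (hs.isPartialIsometry hg w.2).isStarProjection_initial)
    (fun v w hvw ↦ ?_) _
  beta_reduce
  rw [mul_assoc, ← mul_assoc (v : H →L[ℂ] H), hs.pairwise v.2 w.2 (Subtype.coe_ne_coe.2 hvw),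
    zero_mul, mul_zero]

theorem sum_initial_mul_star (hs : IsEquivalentSet M g s) (hg : IsStarProjection g) (w : s) :
    (∑ v : s, star (v : H →L[ℂ] H) * v) * star (w : H →L[ℂ] H) = star (w : H →L[ℂ] H) := by
  rw [Finset.sum_mul, Finset.sum_eq_single_of_mem w (Finset.mem_univ w), mul_assoc,
    (hs.isPartialIsometry hg w.2).star_mul_final]
  intro v _ hvw
  rw [mul_assoc, hs.pairwise v.2 w.2 (Subtype.coe_ne_coe.2 hvw), mul_zero]

end IsEquivalentSet

theorem exists_finite_cover (hM : M.IsFactor) (hfin : M.IsFinite) (hgM : g ∈ M)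
    (hg : IsStarProjection g) (hg0 : g ≠ 0) :
    ∃ (n : ℕ) (w : Fin n → H →L[ℂ] H), (∀ i, w i ∈ M ∧ IsPartialIsometry (w i) ∧ g * w i = w i) ∧
      ∑ i, star (w i) * w i = 1 := by
  obtain ⟨s, hs⟩ := IsEquivalentSet.exists_maximal M g
  have := (hs.prop.finite hfin hg hg0).fintype
  set q := ∑ w : s, star (w : H →L[ℂ] H) * w
  have hqM : q ∈ M :=
    sum_mem fun w _ ↦ mul_mem (star_mem (hs.prop.mem w w.2)) (hs.prop.mem w w.2)
  obtain ⟨V, hVM, hV, hVe, hgV, -, hmax⟩ := exists_maximal_partialIsometry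
    (sub_mem (one_mem M) hqM) hgM (hs.prop.isStarProjection_sum_initial hg).one_sub hg 0 0
    fun e' heM f' hfM he hf _ _ he0 hf0 ↦ by
      simpa using exists_ne_zero_partialIsometry hM heM hfM he hf he0 hf0
  have hVV : star V * V = 1 - q := by
    refine hmax.resolve_right fun hVg ↦ hg0 ?_
    refine IsEquivalentSet.eq_zero_of_maximal hs hVM hVg fun w hw ↦ ?_
    rw [← hVe, mul_assoc, sub_mul, one_mul, hs.prop.sum_initial_mul_star hg ⟨w, hw⟩, sub_self,
      mul_zero]
  let W : Option s → H →L[ℂ] H := fun o ↦ o.elim V (↑)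
  have hW (o) : W o ∈ M ∧ IsPartialIsometry (W o) ∧ g * W o = W o := by
    rcases o with _ | w
    · exact ⟨hVM, hV, hgV⟩
    · have hw := hs.prop.isPartialIsometry hg w.2
      exact ⟨hs.prop.mem w w.2, hw, by rw [← hs.prop.mul_star_eq w w.2]; exact hw⟩
  let e := Fintype.equivFin (Option s)
  refine ⟨_, W ∘ e.symm, fun i ↦ hW _, ?_⟩
  calc ∑ i, star (W (e.symm i)) * W (e.symm i) = ∑ o, star (W o) * W o :=
        e.symm.sum_comp fun o ↦ star (W o) * W o
    _ = star V * V + q := Fintype.sum_option _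
    _ = 1 := by rw [hVV, sub_add_cancel]

theorem exists_vector_state {ι : Type*} [Fintype ι] {η : ι → H} (hη : ∃ i, η i ≠ 0) :
    ∃ ψ : (H →L[ℂ] H) →L[ℂ] ℂ, ‖ψ‖ ≤ 1 ∧ ψ 1 = 1 ∧
      ∀ x, ψ (star x * x) = ((∑ i, ‖η i‖ ^ 2)⁻¹ * ∑ i, ‖x (η i)‖ ^ 2 : ℝ) := by
  set c : ℝ := ∑ i, ‖η i‖ ^ 2 with hc
  have hcpos : 0 < c := by
    obtain ⟨i, hi⟩ := hη
    exact Finset.sum_pos' (fun i _ ↦ by positivity) ⟨i, Finset.mem_univ i, by positivity⟩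
  let ψ : (H →L[ℂ] H) →L[ℂ] ℂ :=
    ((c⁻¹ : ℝ) : ℂ) • ∑ i, innerSL ℂ (η i) ∘L ContinuousLinearMap.apply ℂ H (η i)
  have hψ (x) : ψ x = ((c⁻¹ : ℝ) : ℂ) * ∑ i, ⟪η i, x (η i)⟫ := by simp [ψ, sum_apply]
  have hψs (x : H →L[ℂ] H) : ψ (star x * x) = (c⁻¹ * ∑ i, ‖x (η i)‖ ^ 2 : ℝ) := by
    rw [hψ, Complex.ofReal_mul, Complex.ofReal_sum]
    congr 1
    refine Finset.sum_congr rfl fun i _ ↦ ?_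
    rw [inner_star_mul_self_apply]
    simp
  refine ⟨ψ, ContinuousLinearMap.opNorm_le_bound _ zero_le_one fun x ↦ ?_, ?_, hψs⟩
  · rw [hψ, norm_mul, Complex.norm_real, norm_inv, Real.norm_of_nonneg hcpos.le, one_mul,
      inv_mul_le_iff₀ hcpos, hc, Finset.sum_mul]
    refine (norm_sum_le _ _).trans (Finset.sum_le_sum fun i _ ↦ ?_)
    calc ‖⟪η i, x (η i)⟫‖ ≤ ‖η i‖ * (‖x‖ * ‖η i‖) :=
          (norm_inner_le_norm _ _).trans (by gcongr; exact x.le_opNorm _)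
      _ = ‖η i‖ ^ 2 * ‖x‖ := by ring
  · have hone := hψs 1
    rw [star_one, one_mul] at hone
    rw [hone]
    exact congrArg Complex.ofReal (inv_mul_cancel₀ hcpos.ne')

section Cover

variable {ι : Type*} [Fintype ι] {w : ι → H →L[ℂ] H} {ξ : H} {κ : ℝ}

theorem sum_norm_sq_apply_of_sum_eq_one (hsum : ∑ i, star (w i) * w i = 1) (ζ : H) :
    ∑ i, ‖w i ζ‖ ^ 2 = ‖ζ‖ ^ 2 := by
  have hone : (⟪ζ, (1 : H →L[ℂ] H) ζ⟫).re = ‖ζ‖ ^ 2 := inner_self_eq_norm_sq (𝕜 := ℂ) ζ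
  rw [← hsum, sum_apply, inner_sum, Complex.re_sum] at hone
  simpa only [re_inner_star_mul_self] using hone

theorem exists_star_apply_ne_zero (hgM : g ∈ M) (hg : IsStarProjection g) (hgξ : g ξ ≠ 0)
    (h : ∀ x ∈ M, x * g = x → g * x = x → ‖x ξ‖ ^ 2 ≤ κ * ‖star x ξ‖ ^ 2)
    (hwM : ∀ i, w i ∈ M) (hgw : ∀ i, g * w i = w i) (hsum : ∑ i, star (w i) * w i = 1) :
    ∃ i, star (w i) ξ ≠ 0 := by
  by_contra! hcon
  have hzero (i) : w i (g ξ) = 0 := by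
    have hle := h (w i * g) (mul_mem (hwM i) hgM) (by rw [mul_assoc, hg.isIdempotentElem.eq])
      (by rw [← mul_assoc, hgw])
    rw [star_mul, mul_apply_eq_comp, mul_apply_eq_comp, hcon, map_zero, norm_zero] at hle
    simpa using hle
  have hnorm := sum_norm_sq_apply_of_sum_eq_one hsum (g ξ)
  simp [hzero, eq_comm (a := (0 : ℝ)), hgξ] at hnorm

/-- Decomposing along `1 = ∑ wⱼ⋆ wⱼ` reduces the inequality to the elements `wⱼ x wᵢ⋆` of the
corner of `g`. -/
theorem sum_norm_sq_apply_star_le (hg : IsSelfAdjoint g)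
    (h : ∀ x ∈ M, x * g = x → g * x = x → ‖x ξ‖ ^ 2 ≤ κ * ‖star x ξ‖ ^ 2)
    (hwM : ∀ i, w i ∈ M) (hgw : ∀ i, g * w i = w i) (hsum : ∑ i, star (w i) * w i = 1)
    {x : H →L[ℂ] H} (hx : x ∈ M) :
    ∑ i, ‖x (star (w i) ξ)‖ ^ 2 ≤ κ * ∑ i, ‖star x (star (w i) ξ)‖ ^ 2 := by
  have hwg (i) : star (w i) * g = star (w i) := by rw [← hg.star_eq, ← star_mul, hgw]
  calc ∑ i, ‖x (star (w i) ξ)‖ ^ 2 = ∑ i, ∑ j, ‖(w j * x * star (w i)) ξ‖ ^ 2 :=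
        Finset.sum_congr rfl fun i _ ↦ (sum_norm_sq_apply_of_sum_eq_one hsum _).symm
    _ ≤ ∑ i, ∑ j, κ * ‖star (w j * x * star (w i)) ξ‖ ^ 2 := by
        refine Finset.sum_le_sum fun i _ ↦ Finset.sum_le_sum fun j _ ↦ h _ ?_ ?_ ?_
        · exact mul_mem (mul_mem (hwM j) hx) (star_mem (hwM i))
        · rw [mul_assoc, hwg]
        · rw [← mul_assoc, ← mul_assoc, hgw]
    _ = ∑ j, ∑ i, κ * ‖(w i * star x * star (w j)) ξ‖ ^ 2 := by
        simp only [star_mul, star_star, mul_assoc]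
        exact Finset.sum_comm
    _ = κ * ∑ j, ‖star x (star (w j) ξ)‖ ^ 2 := by
        simp only [← Finset.mul_sum]
        congr 1
        exact Finset.sum_congr rfl fun j _ ↦ sum_norm_sq_apply_of_sum_eq_one hsum _

end Cover

theorem exists_almost_trace (hM : M.IsFactor) (hfin : M.IsFinite) {κ : ℝ} (hκ : 1 < κ) :
    ∃ ψ : (H →L[ℂ] H) →L[ℂ] ℂ, ‖ψ‖ ≤ 1 ∧ ψ 1 = 1 ∧ (∀ x, 0 ≤ ψ (star x * x)) ∧
      ∀ x ∈ M, (ψ (star x * x)).re ≤ κ * (ψ (x * star x)).re := by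
  obtain ⟨ξ, hξ⟩ : ∃ ξ : H, ξ ≠ 0 := by
    by_contra! hcon
    exact hM.one_ne_zero (by ext ξ; rw [hcon ξ, map_zero, map_zero])
  obtain ⟨g, hgM, hg, hgξ, hb⟩ := exists_projection_almost_tracial hM hfin hξ hκ
  have hcorner (x : H →L[ℂ] H) (hx : x ∈ M) (hxg : x * g = x) (hgx : g * x = x) :=
    norm_sq_apply_le_of_forall_partialIsometry hg (by positivity) hb hx hxg hgx
  obtain ⟨n, w, hw, hsum⟩ := exists_finite_cover hM hfin hgM hg (by rintro rfl; exact hgξ rfl)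
  have hwM (i) := (hw i).1
  have hgw (i) := (hw i).2.2
  obtain ⟨ψ, hψ, hψ1, hψs⟩ := exists_vector_state (η := fun i ↦ star (w i) ξ)
    (exists_star_apply_ne_zero hgM hg hgξ hcorner hwM hgw hsum)
  refine ⟨ψ, hψ, hψ1, fun x ↦ ?_, fun x hx ↦ ?_⟩
  · rw [hψs, Complex.zero_le_real]
    positivity
  · have hxx := hψs (star x)
    rw [star_star] at hxx
    rw [hxx, hψs, Complex.ofReal_re, Complex.ofReal_re, mul_left_comm]
    gcongr
    exact sum_norm_sq_apply_star_le hg.isSelfAdjoint hcorner hwM hgw hsum hx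

/-- States of `B(H)` that are tracial on `M`. -/
structure IsTracialStateOn (M : VonNeumannAlgebra H) (τ : (H →L[ℂ] H) →L[ℂ] ℂ) : Prop where
  map_one : τ 1 = 1
  nonneg : ∀ x, 0 ≤ τ (star x * x)
  tracial : ∀ x ∈ M, τ (star x * x) = τ (x * star x)

theorem exists_isTracialStateOn (hM : M.IsFactor) (hfin : M.IsFinite) :
    ∃ τ, IsTracialStateOn M τ := by
  have hκ (n : ℕ) : 1 < 1 + 1 / ((n : ℝ) + 1) := lt_add_of_pos_right 1 (by positivity)
  choose ψ hψ hψ1 hpos htr using fun n : ℕ ↦ exists_almost_trace hM hfin (hκ n)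
  let f : ℕ → WeakDual ℂ (H →L[ℂ] H) := fun n ↦ StrongDual.toWeakDual (ψ n)
  let U : Ultrafilter ℕ := Filter.hyperfilter ℕ
  obtain ⟨τ, -, hτ⟩ := (isCompact_iff_ultrafilter_le_nhds.1
    (WeakDual.isCompact_closedBall (0 : StrongDual ℂ (H →L[ℂ] H)) 1)) (U.map f) (by
      refine Filter.le_principal_iff.2 (Filter.mem_map.2 (Filter.univ_mem' fun n ↦ ?_))
      simpa [f] using hψ n)
  have hlim (x : H →L[ℂ] H) : Filter.Tendsto (fun n ↦ ψ n x) U (nhds (τ x)) :=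
    ((WeakDual.eval_continuous x).tendsto τ).comp (show Filter.Tendsto f U (nhds τ) from hτ)
  have hnonneg (x : H →L[ℂ] H) : 0 ≤ τ (star x * x) := ge_of_tendsto' (hlim _) fun n ↦ hpos n x
  have hle (x) (hx : x ∈ M) : (τ (star x * x)).re ≤ (τ (x * star x)).re := by
    have hU : Filter.Tendsto (fun n : ℕ ↦ 1 + 1 / ((n : ℝ) + 1)) U (nhds 1) := by
      simpa using (tendsto_one_div_add_atTop_nhds_zero_nat.mono_left
        Nat.hyperfilter_le_atTop).const_add (1 : ℝ)
    have hre (y : H →L[ℂ] H) := (Complex.continuous_re.tendsto _).comp (hlim y)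
    refine le_of_tendsto_of_tendsto' (hre (star x * x)) ?_ fun n ↦ htr n x hx
    simpa using hU.mul (hre (x * star x))
  refine ⟨WeakDual.toStrongDual τ, ⟨?_, hnonneg, fun x hx ↦ Complex.ext ?_ ?_⟩⟩
  · exact tendsto_nhds_unique (hlim 1) (by simp only [hψ1]; exact tendsto_const_nhds)
  · exact (hle x hx).antisymm (by simpa using hle (star x) (star_mem hx))
  · have hstar : 0 ≤ τ (x * star x) := by simpa using hnonneg (star x)
    exact (Complex.nonneg_iff.1 (hnonneg x)).2.symm.trans (Complex.nonneg_iff.1 hstar).2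

namespace IsTracialStateOn

variable {τ : (H →L[ℂ] H) →L[ℂ] ℂ} {x v : H →L[ℂ] H}

theorem re_mono (hτ : IsTracialStateOn M τ) {S T : H →L[ℂ] H} (h : S ≤ T) :
    (τ S).re ≤ (τ T).re := by
  obtain ⟨y, hy⟩ := CStarAlgebra.nonneg_iff_eq_star_mul_self.1 (sub_nonneg.2 h)
  have hnonneg := (Complex.nonneg_iff.1 (hτ.nonneg y)).1
  rwa [← hy, map_sub, Complex.sub_re, sub_nonneg] at hnonneg

theorem eq_zero_of_isPartialIsometry (hτ : IsTracialStateOn M τ) (hM : M.IsFactor)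
    (hfin : M.IsFinite) (hvM : v ∈ M) (hv : IsPartialIsometry v)
    (hτv : (τ (star v * v)).re = 0) : v = 0 := by
  by_contra hv0
  have hp := hv.isStarProjection_initial
  obtain ⟨n, w, hw, hsum⟩ := exists_finite_cover hM hfin (mul_mem (star_mem hvM) hvM) hp
    (by rwa [Ne, CStarRing.star_mul_self_eq_zero_iff])
  have hle (i) : w i * star (w i) ≤ star v * v :=
    ((hw i).2.1.isStarProjection_final.le_iff_mul_eq_right hp).2 (by rw [← mul_assoc, (hw i).2.2])
  have hτ1 : (τ 1).re ≤ 0 := by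
    rw [← hsum, map_sum, Complex.re_sum]
    refine Finset.sum_nonpos fun i _ ↦ ?_
    rw [hτ.tracial _ (hw i).1, ← hτv]
    exact hτ.re_mono (hle i)
  rw [hτ.map_one, Complex.one_re] at hτ1
  exact one_pos.not_ge hτ1

theorem norm_sq_apply_le (hτ : IsTracialStateOn M τ) (hM : M.IsFactor) (hfin : M.IsFinite)
    (hx : x ∈ M) (hx1 : ‖x‖ ≤ 1) (hτx : τ (star x * x) = 0) {n : ℕ} (hn : 0 < n) (ζ : H) :
    ‖x ζ‖ ^ 2 ≤ (n : ℝ)⁻¹ * ‖ζ‖ ^ 2 := by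
  obtain ⟨v, hv, hle, hle', -⟩ := exists_layers hx hx1 (.one _) (mul_one x) (one_mul x) hn
  have hsum : ∑ k ∈ Finset.range n, (τ (star (v (k + 1)) * v (k + 1))).re ≤ 0 := by
    have hre := hτ.re_mono hle'
    rw [hτx, ← Complex.coe_smul, map_smul, map_sum, Complex.coe_smul, Complex.smul_re,
      Complex.re_sum, Complex.zero_re, smul_eq_mul, inv_mul_le_iff₀ (by positivity),
      mul_zero] at hre
    exact hre
  have hnonneg (k : ℕ) : 0 ≤ (τ (star (v (k + 1)) * v (k + 1))).re :=
    (Complex.nonneg_iff.1 (hτ.nonneg _)).1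
  have hzero (k) (hk : k ∈ Finset.range n) : v (k + 1) = 0 :=
    hτ.eq_zero_of_isPartialIsometry hM hfin (hv _).1 (hv _).2.1 <|
      (Finset.sum_eq_zero_iff_of_nonneg fun k _ ↦ hnonneg k).1
        (hsum.antisymm (Finset.sum_nonneg fun k _ ↦ hnonneg k)) k hk
  refine (norm_sq_apply_le_of_star_mul_self_le (hv 0).2.1 hle ζ).trans_eq ?_
  rw [Finset.sum_eq_zero fun k hk ↦ by rw [hzero k hk, zero_apply, norm_zero, sq, zero_mul],
    add_zero]

theorem eq_zero (hτ : IsTracialStateOn M τ) (hM : M.IsFactor) (hfin : M.IsFinite) (hx : x ∈ M)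
    (hτx : τ (star x * x) = 0) : x = 0 := by
  wlog hx1 : ‖x‖ ≤ 1 generalizing x
  · have hx0 : 0 < ‖x‖ := by linarith
    have hscaled := this (x := ((‖x‖⁻¹ : ℝ) : ℂ) • x) (M.toStarSubalgebra.smul_mem hx _)
      (by rw [star_smul, smul_mul_smul_comm, map_smul, hτx, smul_zero])
      (by rw [norm_smul, Complex.norm_real, norm_inv, norm_norm, inv_mul_cancel₀ hx0.ne'])
    exact (smul_eq_zero.1 hscaled).resolve_left (mod_cast inv_ne_zero hx0.ne')
  ext ζ
  have hlim : Filter.Tendsto (fun n : ℕ ↦ (n : ℝ)⁻¹ * ‖ζ‖ ^ 2) Filter.atTop (nhds 0) := by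
    simpa using tendsto_inv_atTop_nhds_zero_nat.mul_const (‖ζ‖ ^ 2)
  have hle : ‖x ζ‖ ^ 2 ≤ 0 := ge_of_tendsto hlim <| Filter.eventually_atTop.2
    ⟨1, fun n hn ↦ hτ.norm_sq_apply_le hM hfin hx hx1 hτx hn ζ⟩
  simpa using hle

end IsTracialStateOn

theorem exists_faithful_tracialState_of_injective {A : Type*} [CStarAlgebra A] (hM : M.IsFactor)
    (hfin : M.IsFinite) (φ : A →⋆ₐ[ℂ] M.toStarSubalgebra) (hφ : Function.Injective φ) :
    ∃ τ : A →L[ℂ] ℂ, IsTracialState τ ∧ IsFaithfulFunctional τ := by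
  obtain ⟨τ, hτ⟩ := exists_isTracialStateOn hM hfin
  let ψ : A →⋆ₐ[ℂ] (H →L[ℂ] H) := M.toStarSubalgebra.subtype.comp φ
  have hψM (a : A) : ψ a ∈ M := (φ a).2
  have hψ : Function.Injective ψ := Subtype.val_injective.comp hφ
  let Ψ : A →L[ℂ] (H →L[ℂ] H) := (ψ : A →ₗ[ℂ] (H →L[ℂ] H)).mkContinuous 1 fun a ↦
    (NonUnitalStarAlgHom.norm_apply_le ψ a).trans_eq (one_mul _).symm
  have hΨ (a : A) : (τ ∘L Ψ) a = τ (ψ a) := rfl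
  refine ⟨τ ∘L Ψ, ⟨fun x ↦ ?_, ?_, fun x ↦ ?_⟩, fun x hx ↦ ?_⟩
  · rw [hΨ, map_mul, map_star]
    exact hτ.nonneg _
  · rw [hΨ, map_one, hτ.map_one]
  · rw [hΨ, hΨ, map_mul ψ, map_mul ψ, map_star]
    exact hτ.tracial _ (hψM x)
  · rw [hΨ, map_mul, map_star] at hx
    exact hψ (by rw [map_zero, hτ.eq_zero hM hfin (hψM x) hx])

end FiniteFactor

section Kernel

theorem posSemidef_smul_one {X : Type*} {k : Matrix X X ℂ} (hk : k.PosSemidef) :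
    (Matrix.of fun x y ↦ k x y • (1 : ℂ →L[ℂ] ℂ)).PosSemidef := by
  have hherm (x y : X) : star (k x y) = k y x := hk.1.apply y x
  have htfae (K : Matrix X X (ℂ →L[ℂ] ℂ)) : K.PosSemidef ↔ K.IsHermitian ∧
      ∀ c : X →₀ ℂ, 0 ≤ RCLike.re (c.sum fun x z ↦ c.sum fun y w ↦ inner ℂ (K y x z) w) :=
    RKHS.posSemidef_tfae.out 0 2
  refine (htfae _).2 ⟨?_, fun c ↦ ?_⟩
  · ext x y
    simp [Matrix.conjTranspose_apply, ← hherm y x]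
  · refine (Complex.nonneg_iff.1 (hk.2 c)).1.trans_eq (congrArg Complex.re ?_)
    refine Finsupp.sum_congr fun x _ ↦ Finsupp.sum_congr fun y _ ↦ ?_
    simp only [Matrix.of_apply, smul_apply, one_apply_eq_self, smul_eq_mul,
      RCLike.inner_apply, map_mul, ← RCLike.star_def, hherm y x]
    ring

theorem exists_total_of_posSemidef {X : Type u} {k : Matrix X X ℂ} (hk : k.PosSemidef) :
    ∃ (H : Type u) (_ : NormedAddCommGroup H) (_ : InnerProductSpace ℂ H) (_ : CompleteSpace H)
      (v : X → H), (∀ x y, inner ℂ (v x) (v y) = k x y) ∧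
        Dense (Submodule.span ℂ (Set.range v) : Set H) := by
  let K : Matrix X X (ℂ →L[ℂ] ℂ) := Matrix.of fun x y ↦ k x y • 1
  have : Fact K.PosSemidef := ⟨posSemidef_smul_one hk⟩
  refine ⟨RKHS.OfKernel K, inferInstance, inferInstance, inferInstance,
    fun x ↦ RKHS.kerFun (RKHS.OfKernel K) x 1, fun x y ↦ ?_, ?_⟩
  · rw [← RKHS.kernel_inner, RKHS.OfKernel.kernel_ofKernel]
    simpa [K] using hk.1.apply x y
  · have hspan := Submodule.dense_iff_topologicalClosure_eq_top.2
      (RKHS.kerFun_dense (RKHS.OfKernel K))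
    refine hspan.mono (Submodule.span_le.2 ?_)
    rintro _ ⟨x, z, rfl⟩
    have hz : RKHS.kerFun (RKHS.OfKernel K) x z = z • RKHS.kerFun (RKHS.OfKernel K) x 1 := by
      rw [← map_smul, smul_eq_mul, mul_one]
    rw [hz]
    exact Submodule.smul_mem _ _ (Submodule.subset_span ⟨x, rfl⟩)

end Kernel

section Total

open ContinuousLinearMap Filter Topology

variable {ι X : Type*} {H E : Type*} [NormedAddCommGroup H] [InnerProductSpace ℂ H]
  [NormedAddCommGroup E] [NormedSpace ℂ E] {v w : X → H} {l : Filter ι}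

local notation "⟪" x ", " y "⟫" => inner ℂ x y

theorem norm_linearCombination_eq_of_inner_eq (h : ∀ x y, ⟪w x, w y⟫ = ⟪v x, v y⟫) (a : X →₀ ℂ) :
    ‖Finsupp.linearCombination ℂ w a‖ = ‖Finsupp.linearCombination ℂ v a‖ := by
  simp only [@norm_eq_sqrt_re_inner ℂ, Finsupp.linearCombination_apply, Finsupp.sum, sum_inner,
    inner_sum, inner_smul_left, inner_smul_right, h]

theorem norm_sum_star_smul_eq_of_inner_eq_swap (h : ∀ x y, ⟪w x, w y⟫ = ⟪v y, v x⟫) (a : X →₀ ℂ) :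
    ‖a.sum fun x z ↦ star z • w x‖ = ‖a.sum fun x z ↦ z • v x‖ := by
  rw [@norm_eq_sqrt_re_inner ℂ, @norm_eq_sqrt_re_inner ℂ]
  simp only [Finsupp.sum, sum_inner, inner_sum, inner_smul_left, inner_smul_right, h,
    Finset.mul_sum, RCLike.star_def, RCLike.conj_conj]
  rw [Finset.sum_comm]
  congr! 4
  ring

theorem eq_of_forall_apply_eq_of_dense (hv : Dense (Submodule.span ℂ (Set.range v) : Set H))
    {S T : H →L[ℂ] E} (h : ∀ x, S (v x) = T (v x)) : S = T :=
  ContinuousLinearMap.ext_on hv (Set.eqOn_range.2 (funext h))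

theorem exists_isometry_of_inner_eq [CompleteSpace H]
    (hv : Dense (Submodule.span ℂ (Set.range v) : Set H)) (h : ∀ x y, ⟪w x, w y⟫ = ⟪v x, v y⟫) :
    ∃ V : H →L[ℂ] H, (∀ x, V (v x) = w x) ∧ star V * V = 1 := by
  obtain ⟨V, hV, hVV⟩ := exists_partialIsometry_of_norm_eq
    (norm_linearCombination_eq_of_inner_eq h)
  refine ⟨V, fun x ↦ by simpa using hV (Finsupp.single x 1), ?_⟩
  rw [hVV, Finsupp.range_linearCombination]
  ext ξ
  exact Submodule.starProjection_eq_self_iff.2 (hv ξ)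

theorem tendsto_apply_of_dense (hv : Dense (Submodule.span ℂ (Set.range v) : Set H))
    {T : ι → H →L[ℂ] E} {S : H →L[ℂ] E} {C : ℝ} (hT : ∀ i, ‖T i‖ ≤ C)
    (h : ∀ x, Tendsto (fun i ↦ T i (v x)) l (𝓝 (S (v x)))) (ξ : H) :
    Tendsto (fun i ↦ T i ξ) l (𝓝 (S ξ)) := by
  have hequi : Equicontinuous ((↑) ∘ T) ↔ ∃ C, ∀ i, ‖T i‖ ≤ C :=
    (NormedSpace.equicontinuous_TFAE T).out 1 5
  have hclosed := (hequi.2 ⟨C, hT⟩).isClosed_setOfPred_tendsto (l := l) S.continuous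
  have hspan : (Submodule.span ℂ (Set.range v) : Set H) ⊆
      {ξ | Tendsto (fun i ↦ T i ξ) l (𝓝 (S ξ))} := fun ξ hξ ↦ by
    induction hξ using Submodule.span_induction with
    | mem ξ hξ => obtain ⟨x, rfl⟩ := hξ; exact h x
    | zero => simpa using tendsto_const_nhds
    | add ξ η _ _ hξ hη => simpa using hξ.add hη
    | smul c ξ _ hξ => simpa using hξ.const_smul c
  exact hclosed.closure_subset_iff.2 hspan (hv ξ)

theorem tendsto_inner_apply_of_dense (hv : Dense (Submodule.span ℂ (Set.range v) : Set H))
    {T : ι → H →L[ℂ] H} {S : H →L[ℂ] H} {C : ℝ} (hT : ∀ i, ‖T i‖ ≤ C)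
    (h : ∀ x y, Tendsto (fun i ↦ ⟪v x, T i (v y)⟫) l (𝓝 ⟪v x, S (v y)⟫)) (ξ η : H) :
    Tendsto (fun i ↦ ⟪ξ, T i η⟫) l (𝓝 ⟪ξ, S η⟫) := by
  have hright (x : X) (η : H) : Tendsto (fun i ↦ ⟪v x, T i η⟫) l (𝓝 ⟪v x, S η⟫) :=
    tendsto_apply_of_dense hv (T := fun i ↦ innerSL ℂ (v x) ∘L T i) (S := innerSL ℂ (v x) ∘L S)
      (C := ‖v x‖ * C) (fun i ↦ (opNorm_comp_le _ _).trans <| by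
        rw [innerSL_apply_norm]; gcongr; exact hT i) (h x) η
  have hleft : Tendsto (fun i ↦ ⟪T i η, ξ⟫) l (𝓝 ⟪S η, ξ⟫) :=
    tendsto_apply_of_dense hv (T := fun i ↦ innerSL ℂ (T i η)) (S := innerSL ℂ (S η))
      (C := C * ‖η‖) (fun i ↦ by rw [innerSL_apply_norm]; exact (T i).le_of_opNorm_le (hT i) η)
      (fun x ↦ by simpa using (hright x η).star) ξ
  simpa using hleft.star

end Total

theorem exists_unitary_of_inner_eq {G X : Type*} [Group G] {H : Type*} [NormedAddCommGroup H]
    [InnerProductSpace ℂ H] [CompleteSpace H] {v : X → H}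
    (hv : Dense (Submodule.span ℂ (Set.range v) : Set H)) (π : G →* Equiv.Perm X)
    (h : ∀ g x y, inner ℂ (v (π g x)) (v (π g y)) = inner ℂ (v x) (v y)) :
    ∃ U : G →* (H →L[ℂ] H), (∀ g x, U g (v x) = v (π g x)) ∧ ∀ g, star (U g) = U g⁻¹ := by
  choose U hU hUU using fun g ↦ exists_isometry_of_inner_eq hv (h g)
  have hone : U 1 = 1 := eq_of_forall_apply_eq_of_dense hv fun x ↦ by simp [hU]
  have hmul (g k) : U (g * k) = U g * U k := eq_of_forall_apply_eq_of_dense hv fun x ↦ by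
    simp [hU, mul_apply_eq_comp]
  refine ⟨{ toFun := U, map_one' := hone, map_mul' := hmul }, hU, fun g ↦ ?_⟩
  calc star (U g) = star (U g) * (U g * U g⁻¹) := by rw [← hmul, mul_inv_cancel, hone, mul_one]
    _ = U g⁻¹ := by rw [← mul_assoc, hUU, one_mul]

/-- The two-sided regular representation attached to a positive definite class function `χ` on a
group `Γ`: a total family of vectors `vec g` whose Gram matrix is given by `χ`, together with the
unitary representations of `Γ` by left and right translations. -/
structure CharacterRep (Γ : Type*) [Group Γ] (χ : Γ → ℂ) (H : Type*) [NormedAddCommGroup H]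
    [InnerProductSpace ℂ H] [CompleteSpace H] where
  vec : Γ → H
  inner_vec : ∀ g h, inner ℂ (vec g) (vec h) = χ (g⁻¹ * h)
  dense : Dense (Submodule.span ℂ (Set.range vec) : Set H)
  left : Γ →* (H →L[ℂ] H)
  left_vec : ∀ a g, left a (vec g) = vec (a * g)
  star_left : ∀ a, star (left a) = left a⁻¹
  right : Γ →* (H →L[ℂ] H)
  right_vec : ∀ b g, right b (vec g) = vec (g * b⁻¹)
  star_right : ∀ b, star (right b) = right b⁻¹

theorem exists_characterRep {Γ : Type u} [Group Γ] {χ : Γ → ℂ}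
    (hχ : (Matrix.of fun g h ↦ χ (g⁻¹ * h)).PosSemidef) (hconj : ∀ k g, χ (k * g * k⁻¹) = χ g) :
    ∃ (H : Type u) (_ : NormedAddCommGroup H) (_ : InnerProductSpace ℂ H) (_ : CompleteSpace H),
      Nonempty (CharacterRep Γ χ H) := by
  obtain ⟨H, _, _, _, v, hv, hd⟩ := exists_total_of_posSemidef hχ
  simp only [Matrix.of_apply] at hv
  obtain ⟨L, hL, hL'⟩ := exists_unitary_of_inner_eq hd (MulAction.toPermHom Γ Γ) fun a g h ↦ by
    simp [hv, mul_assoc]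
  obtain ⟨R, hR, hR'⟩ := exists_unitary_of_inner_eq hd
    ((MulAction.toPermHom Γᵐᵒᵖ Γ).comp (MulEquiv.inv' Γ).toMonoidHom) fun b g h ↦ by
      rw [hv, hv, ← hconj b (g⁻¹ * h)]
      simp [mul_assoc]
  exact ⟨H, _, _, _, ⟨v, hv, hd, L, hL, hL', R, hR, hR'⟩⟩

namespace CharacterRep

open ContinuousLinearMap Filter Topology

variable {Γ : Type*} [Group Γ] {χ : Γ → ℂ} {H : Type*} [NormedAddCommGroup H]
  [InnerProductSpace ℂ H] [CompleteSpace H] {x : H →L[ℂ] H}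

local notation "⟪" x ", " y "⟫" => inner ℂ x y

section Translations

variable (R : CharacterRep Γ χ H)

theorem star_left_mul_left (a : Γ) : star (R.left a) * R.left a = 1 := by
  rw [R.star_left, ← map_mul, inv_mul_cancel, map_one]

theorem star_right_mul_right (b : Γ) : star (R.right b) * R.right b = 1 := by
  rw [R.star_right, ← map_mul, inv_mul_cancel, map_one]

theorem norm_left_apply (a : Γ) (ξ : H) : ‖R.left a ξ‖ = ‖ξ‖ :=
  norm_apply_eq_of_star_mul_self_eq (b := 1) (by simp [R.star_left_mul_left]) ξ

theorem norm_right_apply (b : Γ) (ξ : H) : ‖R.right b ξ‖ = ‖ξ‖ :=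
  norm_apply_eq_of_star_mul_self_eq (b := 1) (by simp [R.star_right_mul_right]) ξ

theorem norm_left_le (a : Γ) : ‖R.left a‖ ≤ 1 :=
  opNorm_le_bound _ zero_le_one fun ξ ↦ by rw [R.norm_left_apply, one_mul]

theorem norm_right_le (b : Γ) : ‖R.right b‖ ≤ 1 :=
  opNorm_le_bound _ zero_le_one fun ξ ↦ by rw [R.norm_right_apply, one_mul]

theorem inner_right_right (a b : Γ) (ξ η : H) :
    ⟪R.right a ξ, R.right b η⟫ = ⟪ξ, R.right (a⁻¹ * b) η⟫ := by
  rw [map_mul, ← R.star_right, mul_apply_eq_comp, inner_star_apply_right]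

theorem commute_right_left (b a : Γ) : Commute (R.right b) (R.left a) :=
  eq_of_forall_apply_eq_of_dense R.dense fun g ↦ by
    simp [mul_apply_eq_comp, R.left_vec, R.right_vec, mul_assoc]

theorem right_inv_vec_one (g : Γ) : R.right g⁻¹ (R.vec 1) = R.vec g := by
  rw [R.right_vec, inv_inv, one_mul]

theorem left_right_vec_one (g : Γ) : R.left g (R.right g (R.vec 1)) = R.vec 1 := by
  rw [R.right_vec, R.left_vec, one_mul, mul_inv_cancel]

theorem map_conj (R : CharacterRep Γ χ H) (k g : Γ) : χ (k * g * k⁻¹) = χ g := by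
  have hinner := R.inner_right_right k k (R.vec 1) (R.vec g)
  simpa [R.right_vec, R.inner_vec, mul_assoc] using hinner

theorem inner_vec_inv_vec_inv (g h : Γ) : ⟪R.vec g⁻¹, R.vec h⁻¹⟫ = ⟪R.vec h, R.vec g⟫ := by
  rw [R.inner_vec, R.inner_vec, ← R.map_conj h (h⁻¹ * g)]
  group

end Translations

section VonNeumannAlgebra

/-- The von Neumann algebra generated by the left translations, encoded as the commutant of the
right translations. -/
noncomputable def vonNeumannAlgebra (R : CharacterRep Γ χ H) : VonNeumannAlgebra H where
  toStarSubalgebra := StarSubalgebra.centralizer ℂ (Set.range R.right)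
  centralizer_centralizer' := by simp

variable {R : CharacterRep Γ χ H}

theorem mem_vonNeumannAlgebra : x ∈ R.vonNeumannAlgebra ↔ ∀ b, Commute (R.right b) x := by
  change x ∈ StarSubalgebra.centralizer ℂ (Set.range R.right) ↔ _
  simp only [StarSubalgebra.mem_centralizer_iff, Set.forall_mem_range, R.star_right]
  exact ⟨fun h b ↦ (h b).1, fun h b ↦ ⟨h b, h b⁻¹⟩⟩

theorem left_mem (a : Γ) : R.left a ∈ R.vonNeumannAlgebra :=
  mem_vonNeumannAlgebra.2 fun b ↦ R.commute_right_left b a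

theorem apply_right (hx : x ∈ R.vonNeumannAlgebra) (b : Γ) (ξ : H) :
    x (R.right b ξ) = R.right b (x ξ) :=
  (DFunLike.congr_fun (mem_vonNeumannAlgebra.1 hx b) ξ).symm

theorem eq_zero_of_apply_vec_one (hx : x ∈ R.vonNeumannAlgebra) (h : x (R.vec 1) = 0) : x = 0 :=
  eq_of_forall_apply_eq_of_dense R.dense fun g ↦ by
    rw [← R.right_inv_vec_one, apply_right hx, h, map_zero, zero_apply]

theorem inner_vec_star_apply (hx : x ∈ R.vonNeumannAlgebra) (g : Γ) :
    ⟪R.vec g, star x (R.vec 1)⟫ = ⟪x (R.vec 1), R.vec g⁻¹⟫ := by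
  rw [inner_star_apply_right, ← R.right_inv_vec_one g, apply_right hx, ← R.right_inv_vec_one g⁻¹,
    ← inner_star_apply_right, R.star_right]

theorem norm_inner_star_apply_le (hx : x ∈ R.vonNeumannAlgebra) (ξ : H) :
    ‖⟪ξ, star x (R.vec 1)⟫‖ ≤ ‖ξ‖ * ‖x (R.vec 1)‖ := by
  have hclosed : IsClosed {ξ | ‖⟪ξ, star x (R.vec 1)⟫‖ ≤ ‖ξ‖ * ‖x (R.vec 1)‖} :=
    isClosed_le (by fun_prop) (by fun_prop)
  refine hclosed.closure_subset_iff.2 (fun ξ hξ ↦ ?_) (R.dense ξ)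
  obtain ⟨a, rfl⟩ := Finsupp.mem_span_range_iff_exists_finsupp.1 hξ
  have hinner : ⟪a.sum fun g z ↦ z • R.vec g, star x (R.vec 1)⟫ =
      ⟪x (R.vec 1), a.sum fun g z ↦ star z • R.vec g⁻¹⟫ := by
    simp only [Finsupp.sum, sum_inner, inner_sum, inner_smul_left, inner_smul_right,
      inner_vec_star_apply hx, RCLike.star_def]
  rw [Set.mem_ofPred_eq, hinner,
    ← norm_sum_star_smul_eq_of_inner_eq_swap R.inner_vec_inv_vec_inv, mul_comm]
  exact norm_inner_le_norm _ _

theorem norm_star_apply_vec_one (hx : x ∈ R.vonNeumannAlgebra) :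
    ‖star x (R.vec 1)‖ = ‖x (R.vec 1)‖ := by
  have hle {x : H →L[ℂ] H} (hx : x ∈ R.vonNeumannAlgebra) :
      ‖star x (R.vec 1)‖ ≤ ‖x (R.vec 1)‖ := by
    have hself := norm_inner_star_apply_le hx (star x (R.vec 1))
    rw [inner_self_eq_norm_sq_to_K, norm_pow, RCLike.norm_ofReal, abs_norm, sq] at hself
    by_contra! hlt
    exact hself.not_gt (mul_lt_mul_of_pos_left hlt ((norm_nonneg _).trans_lt hlt))
  exact (hle hx).antisymm (by simpa using hle (star_mem hx))

theorem isFinite : R.vonNeumannAlgebra.IsFinite := by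
  rintro q hqM hq ⟨v, hvM, hv, rfl⟩
  have hisom (ξ : H) : ‖v ξ‖ = ‖ξ‖ :=
    norm_apply_eq_of_star_mul_self_eq (b := 1) (by simp [hv]) ξ
  have hinner : (⟪R.vec 1, (v * star v) (R.vec 1)⟫).re = ‖R.vec 1‖ ^ 2 := by
    simpa [norm_star_apply_vec_one hvM, hisom] using re_inner_star_mul_self (star v) (R.vec 1)
  have hnorm : ‖(1 - v * star v) (R.vec 1)‖ ^ 2 = 0 := by
    rw [sub_apply, one_apply_eq_self, norm_sub_sq (𝕜 := ℂ), RCLike.re_eq_complex_re, hinner,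
      mul_apply_eq_comp, hisom, norm_star_apply_vec_one hvM, hisom]
    ring
  have hzero : (1 - v * star v) (R.vec 1) = 0 := by simpa using hnorm
  exact (sub_eq_zero.1 (eq_zero_of_apply_vec_one (sub_mem (one_mem _) hqM) hzero)).symm

end VonNeumannAlgebra

end CharacterRep

/-- A normalized function `χ` on a group is mixing along a sequence `s` if conjugation by `s n`
eventually moves every element into a position that commutes with, and is independent of, any
other given element. -/
structure IsMixingAlong {Γ : Type*} [Group Γ] (χ : Γ → ℂ) (s : ℕ → Γ) : Prop where
  map_one : χ 1 = 1
  commute : ∀ g h, ∀ᶠ n in Filter.atTop, Commute h (s n * g * (s n)⁻¹)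
  map_mul_conj : ∀ g h, ∀ᶠ n in Filter.atTop, χ (h * (s n * g * (s n)⁻¹)) = χ h * χ g

namespace CharacterRep

open ContinuousLinearMap Filter Topology commutatorElement

variable {Γ : Type*} [Group Γ] {χ : Γ → ℂ} {s : ℕ → Γ} {H : Type*} [NormedAddCommGroup H]
  [InnerProductSpace ℂ H] [CompleteSpace H]

local notation "⟪" x ", " y "⟫" => inner ℂ x y

section Limits

variable (R : CharacterRep Γ χ H) (hχ : IsMixingAlong χ s)
include hχ

theorem inner_vec_one_self : ⟪R.vec 1, R.vec 1⟫ = 1 := by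
  rw [R.inner_vec, inv_one, one_mul, hχ.map_one]

theorem tendsto_inner_left_right (ξ η : H) :
    Tendsto (fun n ↦ ⟪ξ, R.left (s n) (R.right (s n) η)⟫) atTop
      (𝓝 (⟪ξ, R.vec 1⟫ * ⟪R.vec 1, η⟫)) := by
  have hlim := tendsto_inner_apply_of_dense R.dense (l := atTop)
    (T := fun n ↦ R.left (s n) * R.right (s n))
    (S := InnerProductSpace.rankOne ℂ (R.vec 1) (R.vec 1)) (C := 1 * 1)
    (fun n ↦ (norm_mul_le _ _).trans <|
      mul_le_mul (R.norm_left_le _) (R.norm_right_le _) (norm_nonneg _) zero_le_one)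
    (fun g h ↦ ?_) ξ η
  · simpa [inner_smul_right, mul_comm] using hlim
  · refine tendsto_const_nhds.congr' ?_
    filter_upwards [hχ.map_mul_conj h g⁻¹] with n hn
    simp [R.left_vec, R.right_vec, R.inner_vec, ← hn, mul_comm (χ h), mul_assoc]

theorem tendsto_left_sub_right (g : Γ) (ξ : H) :
    Tendsto (fun n ↦ R.left (s n * g * (s n)⁻¹) ξ - R.right (s n * g * (s n)⁻¹)⁻¹ ξ) atTop
      (𝓝 0) := by
  refine tendsto_apply_of_dense R.dense (C := 1 + 1) (S := 0)
    (T := fun n ↦ R.left (s n * g * (s n)⁻¹) - R.right (s n * g * (s n)⁻¹)⁻¹)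
    (fun n ↦ (norm_sub_le _ _).trans (add_le_add (R.norm_left_le _) (R.norm_right_le _)))
    (fun h ↦ ?_) ξ
  refine tendsto_const_nhds.congr' ?_
  filter_upwards [hχ.commute g h] with n hn
  rw [sub_apply, R.left_vec, R.right_vec, inv_inv, hn.eq, sub_self, zero_apply]

theorem tendsto_inner_right (g : Γ) (ξ η : H) :
    Tendsto (fun n ↦ ⟪ξ, R.right (s n * g * (s n)⁻¹) η⟫) atTop (𝓝 (χ g⁻¹ * ⟪ξ, η⟫)) := by
  have hlim := tendsto_inner_apply_of_dense R.dense (l := atTop) (C := 1) (S := χ g⁻¹ • 1)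
    (T := fun n ↦ R.right (s n * g * (s n)⁻¹)) (fun n ↦ R.norm_right_le _) (fun h k ↦ ?_) ξ η
  · simpa [inner_smul_right] using hlim
  · refine tendsto_const_nhds.congr' ?_
    filter_upwards [hχ.map_mul_conj g⁻¹ (h⁻¹ * k)] with n hn
    rw [R.right_vec, R.inner_vec, smul_apply, one_apply_eq_self, inner_smul_right, R.inner_vec,
      mul_comm, ← hn]
    group

theorem tendsto_norm_right_sub_right (g h : Γ) (ξ : H) :
    Tendsto (fun n ↦ ‖R.right (s n * g * (s n)⁻¹)⁻¹ ξ - R.right (s n * h * (s n)⁻¹)⁻¹ ξ‖ ^ 2) atTop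
      (𝓝 (2 * (1 - (χ (h * g⁻¹)).re) * ‖ξ‖ ^ 2)) := by
  have hinner (n : ℕ) : ⟪R.right (s n * g * (s n)⁻¹)⁻¹ ξ, R.right (s n * h * (s n)⁻¹)⁻¹ ξ⟫ =
      ⟪ξ, R.right (s n * (g * h⁻¹) * (s n)⁻¹) ξ⟫ := by
    rw [R.inner_right_right]
    congr 3
    group
  have hlim := (Complex.continuous_re.tendsto _).comp (R.tendsto_inner_right hχ (g * h⁻¹) ξ ξ)
  rw [inner_self_eq_norm_sq_to_K, mul_inv_rev, inv_inv] at hlim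
  convert (hlim.const_mul 2).const_sub (2 * ‖ξ‖ ^ 2) using 2 with n
  · rw [norm_sub_sq (𝕜 := ℂ), hinner, R.norm_right_apply, R.norm_right_apply]
    simp only [RCLike.re_eq_complex_re, Function.comp_apply]
    ring
  · rw [← RCLike.ofReal_pow, RCLike.ofReal_eq_complex_ofReal, Complex.re_mul_ofReal]
    ring

theorem isFactor : R.vonNeumannAlgebra.IsFactor := by
  have hone := R.inner_vec_one_self hχ
  refine ⟨fun h ↦ ?_, fun z hz hz' ↦ ⟨⟪R.vec 1, z (R.vec 1)⟫, sub_eq_zero.1 ?_⟩⟩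
  · have hvec : R.vec 1 = 0 := DFunLike.congr_fun h (R.vec 1)
    simp [hvec] at hone
  have hinv (g : Γ) : R.left g (R.right g (z (R.vec 1))) = z (R.vec 1) := by
    have hleft : R.left g * z = z * R.left g :=
      VonNeumannAlgebra.mem_commutant_iff.1 hz' _ (left_mem g)
    rw [← apply_right hz, ← mul_apply_eq_comp, hleft, mul_apply_eq_comp, R.left_right_vec_one]
  refine eq_zero_of_apply_vec_one (sub_mem hz (R.vonNeumannAlgebra.smul_mem (one_mem _) _))
    (sub_eq_zero.2 (ext_inner_left ℂ fun ξ ↦ ?_))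
  have hlim := R.tendsto_inner_left_right hχ ξ (z (R.vec 1))
  simp only [hinv] at hlim
  refine (tendsto_nhds_unique tendsto_const_nhds hlim).trans ?_
  simp [inner_smul_right, mul_comm]

variable {R} {p : H →L[ℂ] H}

theorem tendsto_projection_left_projection_left (hpM : p ∈ R.vonNeumannAlgebra)
    (hp : IsStarProjection p) (a b : Γ) (ξ : H) :
    Tendsto (fun n ↦
      (p * R.left (s n * a * (s n)⁻¹) * p * (p * R.left (s n * b * (s n)⁻¹) * p)) ξ -
        R.right (s n * (a * b) * (s n)⁻¹)⁻¹ (p ξ)) atTop (𝓝 0) := by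
  have hpp (ξ : H) : p (p ξ) = p ξ := DFunLike.congr_fun hp.isIdempotentElem ξ
  have hle (ξ : H) : ‖p ξ‖ ≤ ‖ξ‖ := (p.le_of_opNorm_le hp.norm_le ξ).trans (one_mul _).le
  have hlim (g : Γ) := (R.tendsto_left_sub_right hχ g (p ξ)).norm
  refine squeeze_zero_norm (fun n ↦ ?_)
    (by simpa only [norm_zero, add_zero] using (hlim b).add (hlim a))
  generalize hx : s n * a * (s n)⁻¹ = x
  generalize hy : s n * b * (s n)⁻¹ = y
  have hxy : s n * (a * b) * (s n)⁻¹ = x * y := by rw [← hx, ← hy]; group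
  have hsplit : (p * R.left x * p * (p * R.left y * p)) ξ - R.right (x * y)⁻¹ (p ξ) =
      p (R.left x (p (R.left y (p ξ) - R.right y⁻¹ (p ξ)))) +
        R.right y⁻¹ (p (R.left x (p ξ) - R.right x⁻¹ (p ξ))) := by
    have hcomm : R.left x (R.right y⁻¹ (p ξ)) = R.right y⁻¹ (R.left x (p ξ)) :=
      apply_right (left_mem x) _ _
    simp only [mul_apply_eq_comp, map_sub, hpp, apply_right hpM, hcomm, mul_inv_rev, map_mul]
    abel
  rw [hxy, hsplit]
  refine (norm_add_le _ _).trans (add_le_add ?_ ?_)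
  · exact (hle _).trans ((R.norm_left_apply _ _).trans_le (hle _))
  · exact (R.norm_right_apply _ _).trans_le (hle _)

theorem isTypeIIOne {a b : Γ} (hab : (χ ⁅a, b⁆).re < 1) : R.vonNeumannAlgebra.IsTypeIIOne := by
  refine ⟨isFinite, fun p hp ↦ ContinuousLinearMap.ext fun ξ ↦ ?_⟩
  have hdiff : Tendsto (fun n ↦ R.right (s n * (b * a) * (s n)⁻¹)⁻¹ (p ξ) -
      R.right (s n * (a * b) * (s n)⁻¹)⁻¹ (p ξ)) atTop (𝓝 0) := by
    have hlim := (tendsto_projection_left_projection_left hχ hp.mem hp.isStarProjection a b ξ).sub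
      (tendsto_projection_left_projection_left hχ hp.mem hp.isStarProjection b a ξ)
    rw [sub_zero] at hlim
    refine hlim.congr fun n ↦ ?_
    rw [(hp.comm _ (left_mem _) _ (left_mem _)).eq, sub_sub_sub_cancel_left]
  have hzero := tendsto_nhds_unique (R.tendsto_norm_right_sub_right hχ (b * a) (a * b) (p ξ))
    (by simpa using hdiff.norm.pow 2)
  have hcomm : a * b * (b * a)⁻¹ = ⁅a, b⁆ := by group
  rw [hcomm] at hzero
  simpa [sub_eq_zero, hab.ne'] using hzero

end Limits

end CharacterRep

section PositiveSemidefinite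

theorem posSemidef_of_forall_finset {X : Type*} {k : Matrix X X ℂ}
    (h : ∀ F : Finset X, ∃ K : Matrix X X ℂ, K.PosSemidef ∧ ∀ x ∈ F, ∀ y ∈ F, k x y = K x y) :
    k.PosSemidef := by
  classical
  refine ⟨?_, fun c ↦ ?_⟩
  · ext x y
    obtain ⟨K, hK, hkK⟩ := h {x, y}
    rw [Matrix.conjTranspose_apply, hkK y (by simp) x (by simp), hkK x (by simp) y (by simp)]
    exact hK.1.apply x y
  · obtain ⟨K, hK, hkK⟩ := h c.support
    refine (hK.2 c).trans_eq ?_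
    refine Finsupp.sum_congr fun x hx ↦ Finsupp.sum_congr fun y hy ↦ ?_
    rw [hkK x hx y hy]

theorem posSemidef_ite_eq {X Y : Type*} [DecidableEq Y] (f : X → Y) :
    (Matrix.of fun x y ↦ if f x = f y then 1 else 0 : Matrix X X ℂ).PosSemidef :=
  Matrix.PosSemidef.one.submatrix f

theorem posSemidef_prod {ι X : Type*} {k : ι → Matrix X X ℂ} (s : Finset ι)
    (hk : ∀ i ∈ s, (k i).PosSemidef) : (Matrix.of fun x y ↦ ∏ i ∈ s, k i x y).PosSemidef := by
  classical
  induction s using Finset.induction_on with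
  | empty => simpa using posSemidef_ite_eq fun _ : X ↦ ()
  | insert i s hi ih =>
    simp only [Finset.prod_insert hi]
    rw [Finset.forall_mem_insert] at hk
    exact hk.1.hadamard (ih hk.2)

end PositiveSemidefinite

/-- The unrestricted wreath product of `U` with the group of all permutations of `ℕ`. -/
abbrev WreathProduct (U : Type u) [Group U] : Type u := (ℕ → U) ⋊[mulAutArrow] Equiv.Perm ℕ

namespace WreathProduct

open SemidirectProduct
open scoped commutatorElement

variable {U : Type u} [Group U] {g h : WreathProduct U} {S T : Set ℕ} {t : U → ℂ}

theorem mul_left_apply (g h : WreathProduct U) (n : ℕ) :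
    (g * h).left n = g.left n * h.left (g.right⁻¹ n) := rfl

theorem inv_left_apply (g : WreathProduct U) (n : ℕ) : g⁻¹.left n = (g.left (g.right n))⁻¹ := by
  change (g.left (g.right⁻¹⁻¹ n))⁻¹ = _
  rw [inv_inv]

section Support

variable (U) in
/-- The elements of the wreath product that only involve the coordinates in `S`. -/
def supportedOn (S : Set ℕ) : Subgroup (WreathProduct U) where
  carrier := {g | ∀ n ∉ S, g.left n = 1 ∧ g.right n = n}
  one_mem' _ _ := ⟨rfl, rfl⟩
  mul_mem' {g h} hg hh n hn := by
    have hinv : g.right⁻¹ n = n := by rw [Equiv.Perm.inv_eq_iff_eq, (hg n hn).2]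
    simp [mul_left_apply, hinv, hg n hn, hh n hn]
  inv_mem' {g} hg n hn := by
    exact ⟨by simp [inv_left_apply, hg n hn], Equiv.Perm.inv_eq_iff_eq.2 (hg n hn).2.symm⟩

theorem supportedOn_mono (h : S ⊆ T) : supportedOn U S ≤ supportedOn U T :=
  fun _ hg n hn ↦ hg n fun hnS ↦ hn (h hnS)

theorem inr_mem_supportedOn {σ : Equiv.Perm ℕ} (hσ : ∀ n ∉ S, σ n = n) :
    inr σ ∈ supportedOn U S :=
  fun n hn ↦ ⟨rfl, hσ n hn⟩

theorem inr_conj_mem_supportedOn (σ : Equiv.Perm ℕ) (hg : g ∈ supportedOn U S) :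
    inr σ * g * (inr σ)⁻¹ ∈ supportedOn U (σ '' S) := fun n hn ↦ by
  have hσn : σ.symm n ∉ S := fun hmem ↦ hn ⟨_, hmem, σ.apply_symm_apply n⟩
  simp [mul_left_apply, inv_left_apply, hg _ hσn]

theorem disjoint_right (hST : Disjoint S T) (hg : g ∈ supportedOn U S)
    (hh : h ∈ supportedOn U T) : g.right.Disjoint h.right := fun n ↦ by
  by_cases hn : n ∈ S
  · exact .inr (hh n (hST.notMem_of_mem_left hn)).2
  · exact .inl (hg n hn).2

theorem left_eq_one_or_of_disjoint (hST : Disjoint S T) (hg : g ∈ supportedOn U S)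
    (hh : h ∈ supportedOn U T) (n : ℕ) : g.left n = 1 ∨ h.left n = 1 := by
  by_cases hn : n ∈ S
  · exact .inr (hh n (hST.notMem_of_mem_left hn)).1
  · exact .inl (hg n hn).1

theorem left_eq_one_of_right_ne (hST : Disjoint S T) (hg : g ∈ supportedOn U S)
    (hh : h ∈ supportedOn U T) {n : ℕ} (hn : g.right n ≠ n) : h.left n = 1 :=
  (hh n (hST.notMem_of_mem_left (not_not.1 fun hnS ↦ hn (hg n hnS).2))).1

theorem mul_left_of_disjoint (hST : Disjoint S T) (hg : g ∈ supportedOn U S)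
    (hh : h ∈ supportedOn U T) : (g * h).left = g.left * h.left := by
  ext n
  rw [mul_left_apply, Pi.mul_apply]
  congr 1
  by_cases hn : g.right n = n
  · rw [Equiv.Perm.inv_eq_iff_eq.2 hn.symm]
  · have hinv : g.right (g.right⁻¹ n) ≠ g.right⁻¹ n := fun heq ↦
      hn (Equiv.Perm.eq_inv_iff_eq.1 ((g.right.apply_symm_apply n).symm.trans heq))
    rw [left_eq_one_of_right_ne hST hg hh hn, left_eq_one_of_right_ne hST hg hh hinv]

theorem commute_of_disjoint (hST : Disjoint S T) (hg : g ∈ supportedOn U S)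
    (hh : h ∈ supportedOn U T) : Commute g h := by
  refine SemidirectProduct.ext ?_ (disjoint_right hST hg hh).commute.eq
  rw [mul_left_of_disjoint hST hg hh, mul_left_of_disjoint hST.symm hh hg]
  ext n
  obtain hn | hn := left_eq_one_or_of_disjoint hST hg hh n <;> simp [hn]

end Support

section Character

open scoped Classical in
/-- The character of the wreath product induced by a class function `t` on `U`: the product of `t`
over the coordinates, extended by zero off the base group. -/
noncomputable def character (t : U → ℂ) (g : WreathProduct U) : ℂ :=
  if g.right = 1 then ∏ᶠ n, t (g.left n) else 0

theorem character_of_right_eq_one (hg : g.right = 1) : character t g = ∏ᶠ n, t (g.left n) :=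
  if_pos hg

theorem character_of_right_ne_one (hg : g.right ≠ 1) : character t g = 0 := if_neg hg

theorem character_conj (ht : ∀ k u, t (k * u * k⁻¹) = t u) (k g : WreathProduct U) :
    character t (k * g * k⁻¹) = character t g := by
  by_cases hg : g.right = 1
  · rw [character_of_right_eq_one hg, character_of_right_eq_one (by simp [hg]),
      ← finprod_comp_equiv k.right⁻¹ (f := fun n ↦ t (g.left n))]
    refine finprod_congr fun n ↦ ?_
    simp [mul_left_apply, inv_left_apply, hg, ht]
  · rw [character_of_right_ne_one hg, character_of_right_ne_one (by simpa using hg)]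

theorem finite_mulSupport (h1 : t 1 = 1) (hS : S.Finite) (hg : g ∈ supportedOn U S) :
    (Function.mulSupport fun n ↦ t (g.left n)).Finite :=
  hS.subset fun n hn ↦ by
    by_contra hnS
    exact hn (by simp only [(hg n hnS).1, h1])

theorem character_mul_of_disjoint (h1 : t 1 = 1) (hS : S.Finite) (hT : T.Finite)
    (hST : Disjoint S T) (hg : g ∈ supportedOn U S) (hh : h ∈ supportedOn U T) :
    character t (g * h) = character t g * character t h := by
  have hright : (g * h).right = 1 ↔ g.right = 1 ∧ h.right = 1 :=
    (disjoint_right hST hg hh).mul_eq_one_iff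
  by_cases hgh : g.right = 1 ∧ h.right = 1
  · rw [character_of_right_eq_one (hright.2 hgh), character_of_right_eq_one hgh.1,
      character_of_right_eq_one hgh.2,
      ← finprod_mul_distrib (finite_mulSupport h1 hS hg) (finite_mulSupport h1 hT hh),
      mul_left_of_disjoint hST hg hh]
    refine finprod_congr fun n ↦ ?_
    obtain hn | hn := left_eq_one_or_of_disjoint hST hg hh n <;> simp [hn, h1]
  · rw [character_of_right_ne_one (mt hright.1 hgh), eq_comm, mul_eq_zero]
    rw [not_and_or] at hgh
    exact hgh.imp character_of_right_ne_one character_of_right_ne_one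

open scoped Classical in
theorem character_inv_mul (h1 : t 1 = 1) {F : Finset ℕ} (hg : g ∈ supportedOn U F)
    (hh : h ∈ supportedOn U F) : character t (g⁻¹ * h) =
      (if g.right = h.right then 1 else 0) * ∏ n ∈ F, t ((g.left n)⁻¹ * h.left n) := by
  have hright : (g⁻¹ * h).right = 1 ↔ g.right = h.right := inv_mul_eq_one
  by_cases hgh : g.right = h.right
  · have hsupp : (Function.mulSupport fun n ↦ t ((g.left n)⁻¹ * h.left n)) ⊆ F := fun n hn ↦ by
      by_contra hnF
      exact hn (by simp [(hg n hnF).1, (hh n hnF).1, h1])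
    rw [if_pos hgh, one_mul, character_of_right_eq_one (hright.2 hgh),
      ← finprod_eq_prod_of_mulSupport_subset _ hsupp,
      ← finprod_comp_equiv g.right (f := fun n ↦ t ((g.left n)⁻¹ * h.left n))]
    refine finprod_congr fun n ↦ ?_
    simp [mul_left_apply, inv_left_apply]
  · rw [if_neg hgh, zero_mul, character_of_right_ne_one (mt hright.1 hgh)]

end Character

section Finitary

variable (U) in
/-- The restricted wreath product of `U` with the finitary permutations of `ℕ`. -/
def finitary : Subgroup (WreathProduct U) where
  carrier := {g | ∃ N, g ∈ supportedOn U (Set.Iio N)}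
  one_mem' := ⟨0, one_mem _⟩
  mul_mem' := by
    rintro g h ⟨N, hg⟩ ⟨N', hh⟩
    exact ⟨max N N', mul_mem (supportedOn_mono (Set.Iio_subset_Iio (le_max_left _ _)) hg)
      (supportedOn_mono (Set.Iio_subset_Iio (le_max_right _ _)) hh)⟩
  inv_mem' := by
    rintro g ⟨N, hg⟩
    exact ⟨N, inv_mem hg⟩

theorem eventually_mem_supportedOn (g : finitary U) :
    ∀ᶠ N in Filter.atTop, (g : WreathProduct U) ∈ supportedOn U (Set.Iio N) := by
  obtain ⟨N, hN⟩ := g.2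
  filter_upwards [Filter.eventually_ge_atTop N] with N' hN'
  exact supportedOn_mono (Set.Iio_subset_Iio hN') hN

theorem posSemidef_character (h1 : t 1 = 1)
    (ht : (Matrix.of fun u v ↦ t (u⁻¹ * v) : Matrix U U ℂ).PosSemidef) :
    (Matrix.of fun g h : finitary U ↦ character t (g⁻¹ * h : finitary U)).PosSemidef := by
  classical
  refine posSemidef_of_forall_finset fun F ↦ ?_
  obtain ⟨N, hN⟩ := ((Filter.eventually_all_finset F).2
    fun g _ ↦ eventually_mem_supportedOn g).exists
  rw [← Finset.coe_Iio] at hN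
  refine ⟨_, (posSemidef_ite_eq fun g : finitary U ↦ g.1.right).hadamard
    (posSemidef_prod (Finset.Iio N) fun n _ ↦ ht.submatrix fun g : finitary U ↦ g.1.left n),
    fun g hg h hh ↦ character_inv_mul h1 (hN g hg) (hN h hh)⟩

/-- The permutation of `ℕ` exchanging the first two blocks of length `N`. -/
def blockSwap (N : ℕ) : Equiv.Perm ℕ :=
  Function.Involutive.toPerm (fun n ↦ if n < N then n + N else if n < 2 * N then n - N else n)
    fun n ↦ by dsimp only; split_ifs <;> omega

theorem blockSwap_apply_of_lt {N n : ℕ} (hn : n < N) : blockSwap N n = n + N := if_pos hn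

theorem blockSwap_apply_of_le {N n : ℕ} (hn : 2 * N ≤ n) : blockSwap N n = n :=
  (if_neg (by omega)).trans (if_neg (by omega))

theorem disjoint_Iio_image_blockSwap (N : ℕ) :
    Disjoint (Set.Iio N) (blockSwap N '' Set.Iio N) := by
  rw [Set.disjoint_right]
  rintro _ ⟨n, hn, rfl⟩
  simp [blockSwap_apply_of_lt (Set.mem_Iio.1 hn)]

variable (U) in
/-- The elements of the restricted wreath product that move the first `N` coordinates out of the
way; every character of the form `character t` is mixing along them. -/
def swap (N : ℕ) : finitary U :=
  ⟨inr (blockSwap N), 2 * N,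
    inr_mem_supportedOn fun _ hn ↦ blockSwap_apply_of_le (by simpa using hn)⟩

theorem swap_conj_mem_supportedOn {g : finitary U} {N : ℕ}
    (hg : (g : WreathProduct U) ∈ supportedOn U (Set.Iio N)) :
    (swap U N * g * (swap U N)⁻¹ : WreathProduct U) ∈
      supportedOn U (blockSwap N '' Set.Iio N) :=
  inr_conj_mem_supportedOn _ hg

theorem isMixingAlong_swap (h1 : t 1 = 1) (ht : ∀ k u, t (k * u * k⁻¹) = t u) :
    IsMixingAlong (fun g : finitary U ↦ character t g) (swap U) where
  map_one := by
    simp [character_of_right_eq_one (g := (1 : WreathProduct U)) rfl, h1]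
  commute g h := by
    filter_upwards [eventually_mem_supportedOn g, eventually_mem_supportedOn h] with N hg hh
    exact Subtype.ext (commute_of_disjoint (disjoint_Iio_image_blockSwap N) hh
      (swap_conj_mem_supportedOn hg)).eq
  map_mul_conj g h := by
    filter_upwards [eventually_mem_supportedOn g, eventually_mem_supportedOn h] with N hg hh
    exact (character_mul_of_disjoint h1 (Set.finite_Iio N) ((Set.finite_Iio N).image _)
      (disjoint_Iio_image_blockSwap N) hh (swap_conj_mem_supportedOn hg)).trans
        (congrArg _ (character_conj ht _ _))

variable (U t) in
theorem exists_character_commutator_eq_zero :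
    ∃ a b : finitary U, character t (⁅a, b⁆ : finitary U) = 0 := by
  have hmem {i j : ℕ} (hi : i < 3) (hj : j < 3) : inr (Equiv.swap i j) ∈ finitary U :=
    ⟨3, inr_mem_supportedOn fun n hn ↦ by
      rw [Set.mem_Iio] at hn
      exact Equiv.swap_apply_of_ne_of_ne (by omega) (by omega)⟩
  refine ⟨⟨_, hmem (i := 0) (j := 1) (by simp) (by simp)⟩,
    ⟨_, hmem (i := 1) (j := 2) (by simp) (by simp)⟩, character_of_right_ne_one fun hcomm ↦ ?_⟩
  have hswap : ⁅(Equiv.swap 0 1 : Equiv.Perm ℕ), Equiv.swap 1 2⁆ = 1 := hcomm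
  rw [commutatorElement_eq_one_iff_mul_comm] at hswap
  exact absurd (DFunLike.congr_fun hswap 0) (by decide)

variable (U) in
/-- The embedding of `U` as the zeroth coordinate. -/
def single : U →* finitary U :=
  (inl.comp (MonoidHom.mulSingle (fun _ : ℕ ↦ U) 0)).codRestrict (finitary U)
    fun u ↦ ⟨1, fun n hn ↦ ⟨Pi.mulSingle_eq_of_ne (M := fun _ : ℕ ↦ U) (by simpa using hn) u, rfl⟩⟩

theorem character_single (h1 : t 1 = 1) (u : U) : character t (single U u) = t u := by
  have hleft : (single U u : WreathProduct U).left = Pi.mulSingle 0 u := rfl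
  rw [character_of_right_eq_one rfl, hleft, finprod_eq_single _ 0 fun n hn ↦ ?_]
  · rw [Pi.mulSingle_eq_same]
  · rw [Pi.mulSingle_eq_of_ne hn, h1]

end Finitary

end WreathProduct

theorem exists_injective_algHom_of_surjective {R A B C : Type*} [CommRing R] [Ring A] [Ring B]
    [Ring C] [Algebra R A] [Algebra R B] [Algebra R C] {f : A →ₐ[R] B} (hf : Function.Surjective f)
    {g : A →ₐ[R] C} (h : ∀ x, f x = 0 ↔ g x = 0) :
    ∃ k : B →ₐ[R] C, Function.Injective k ∧ ∀ x, k (f x) = g x := by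
  let k : B →ₐ[R] C := (Ideal.Quotient.liftₐ _ g fun x hx ↦ (h x).1 hx).comp
    (Ideal.quotientKerAlgEquivOfSurjective hf).symm.toAlgHom
  have hk (x : A) : k (f x) = g x := by
    simp only [k, AlgHom.comp_apply, AlgEquiv.toAlgHom_apply,
      Ideal.quotientKerAlgEquivOfSurjective_symm_apply]
    rfl
  refine ⟨k, (injective_iff_map_eq_zero k).2 fun b hb ↦ ?_, hk⟩
  obtain ⟨x, rfl⟩ := hf b
  exact (h x).2 ((hk x).symm.trans hb)

section UnitaryGroup

variable {A : Type*} [CStarAlgebra A]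

theorem lift_unitary_surjective :
    Function.Surjective (MonoidAlgebra.lift ℂ A (unitary A) (unitary A).subtype) := by
  rw [← AlgHom.range_eq_top, ← Algebra.toSubmodule_eq_top, eq_top_iff, ← CStarAlgebra.span_unitary,
    Submodule.span_le]
  intro u hu
  exact ⟨MonoidAlgebra.of ℂ _ ⟨u, hu⟩, MonoidAlgebra.lift_of _ _⟩

theorem map_star_of_map_star_unitary {B : Type*} [Ring B] [StarRing B] [Algebra ℂ B]
    [StarModule ℂ B] {φ : A →ₐ[ℂ] B} (h : ∀ u : unitary A, φ (star (u : A)) = star (φ u))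
    (a : A) : φ (star a) = star (φ a) := by
  have ha : a ∈ Submodule.span ℂ (unitary A : Set A) := by
    rw [CStarAlgebra.span_unitary]
    trivial
  induction ha using Submodule.span_induction with
  | mem u hu => exact h ⟨u, hu⟩
  | zero => simp
  | add x y _ _ hx hy => simp only [star_add, map_add, hx, hy]
  | smul c x _ hx => simp only [star_smul, map_smul, hx]

end UnitaryGroup

section Tracial

variable {A : Type*} [CStarAlgebra A] {τ : A →L[ℂ] ℂ}

theorem induction_star_mul_self {p : A → Prop} (star_mul_self : ∀ x, p (star x * x))
    (add : ∀ x y, p x → p y → p (x + y)) (smul : ∀ (c : ℂ) x, p x → p (c • x)) (a : A) :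
    p a := by
  let _ := CStarAlgebra.spectralOrder A
  let _ := CStarAlgebra.spectralOrderedRing A
  have ha : a ∈ Submodule.span ℂ {a : A | 0 ≤ a} := by
    rw [CStarAlgebra.span_nonneg]
    trivial
  induction ha using Submodule.span_induction with
  | mem x hx =>
    obtain ⟨y, rfl⟩ := CStarAlgebra.nonneg_iff_eq_star_mul_self.1 (Set.mem_ofPred.1 hx)
    exact star_mul_self y
  | zero => simpa using star_mul_self 0
  | add x y _ _ hx hy => exact add x y hx hy
  | smul c x _ hx => exact smul c x hx

theorem IsTracialState.map_star (hτ : IsTracialState τ) (a : A) : τ (star a) = star (τ a) := by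
  induction a using induction_star_mul_self with
  | star_mul_self x =>
    rw [star_mul, star_star]
    exact (IsSelfAdjoint.of_nonneg (hτ.nonneg x)).star_eq.symm
  | add x y hx hy => simp only [star_add, map_add, hx, hy]
  | smul c x hx => simp only [star_smul, map_smul, hx, smul_eq_mul, star_mul']

theorem IsTracialState.conj_unitary (hτ : IsTracialState τ) (u : unitary A) (a : A) :
    τ (u * a * star (u : A)) = τ a := by
  induction a using induction_star_mul_self with
  | star_mul_self x =>
    have hconj : (u : A) * (star x * x) * star (u : A) =
        star (x * star (u : A)) * (x * star (u : A)) := by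
      simp only [star_mul, star_star, mul_assoc]
    have hcancel : x * star (u : A) * star (x * star (u : A)) = x * star x := by
      simp only [star_mul, star_star, mul_assoc]
      rw [← mul_assoc (star (u : A)), Unitary.coe_star_mul_self, one_mul]
    rw [hconj, hτ.trace, hcancel, hτ.trace]
  | add x y hx hy => rw [mul_add, add_mul, map_add, map_add, hx, hy]
  | smul c x hx => rw [mul_smul_comm, smul_mul_assoc, map_smul, map_smul, hx]

theorem apply_star_mul_sum_unitary (x : unitary A →₀ ℂ) :
    τ (star (x.sum fun u c ↦ c • (u : A)) * x.sum fun u c ↦ c • (u : A)) =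
      x.sum fun u c ↦ x.sum fun v d ↦ star c * τ ((u⁻¹ * v : unitary A) : A) * d := by
  simp only [Finsupp.sum, star_sum, Finset.sum_mul_sum, map_sum]
  refine Finset.sum_congr rfl fun u _ ↦ Finset.sum_congr rfl fun v _ ↦ ?_
  rw [star_smul, smul_mul_smul_comm, map_smul, smul_eq_mul, mul_right_comm]
  rfl

theorem IsTracialState.posSemidef (hτ : IsTracialState τ) :
    (Matrix.of fun u v : unitary A ↦ τ ((u⁻¹ * v : unitary A) : A)).PosSemidef := by
  refine ⟨?_, fun x ↦ ?_⟩
  · ext u v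
    rw [Matrix.conjTranspose_apply, Matrix.of_apply, Matrix.of_apply, ← hτ.map_star,
      ← Unitary.coe_star, Unitary.star_eq_inv, mul_inv_rev, inv_inv]
  · simp only [Matrix.of_apply]
    rw [← apply_star_mul_sum_unitary]
    exact hτ.nonneg _

end Tracial

namespace CharacterRep

variable {Γ : Type*} [Group Γ] {χ : Γ → ℂ} {H : Type*} [NormedAddCommGroup H]
  [InnerProductSpace ℂ H] [CompleteSpace H]

/-- The left translations as a homomorphism into the von Neumann algebra they generate. -/
noncomputable def leftHom (R : CharacterRep Γ χ H) : Γ →* R.vonNeumannAlgebra.toStarSubalgebra :=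
  R.left.codRestrict R.vonNeumannAlgebra.toStarSubalgebra R.left_mem

variable (R : CharacterRep Γ χ H)

theorem star_leftHom (a : Γ) : star (R.leftHom a) = R.leftHom a⁻¹ := Subtype.ext (R.star_left a)

section GroupAlgebra

variable {G : Type*} [Group G] (j : G →* Γ) (x : MonoidAlgebra ℂ G)

theorem lift_leftHom_apply_vec_one :
    (MonoidAlgebra.lift ℂ _ G (R.leftHom.comp j) x : H →L[ℂ] H) (R.vec 1) =
      x.coeff.sum fun g c ↦ c • R.vec (j g) := by
  simp only [MonoidAlgebra.lift_apply, Finsupp.sum, AddSubmonoidClass.coe_finsetSum,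
    _root_.sum_apply]
  refine Finset.sum_congr rfl fun g _ ↦ ?_
  change x.coeff g • R.left (j g) (R.vec 1) = _
  rw [R.left_vec, mul_one]

theorem inner_lift_leftHom_self :
    inner ℂ ((MonoidAlgebra.lift ℂ _ G (R.leftHom.comp j) x : H →L[ℂ] H) (R.vec 1))
      ((MonoidAlgebra.lift ℂ _ G (R.leftHom.comp j) x : H →L[ℂ] H) (R.vec 1)) =
      x.coeff.sum fun g c ↦ x.coeff.sum fun h d ↦ star c * χ (j (g⁻¹ * h)) * d := by
  rw [lift_leftHom_apply_vec_one]
  simp only [Finsupp.sum, sum_inner, inner_sum, inner_smul_left, inner_smul_right, R.inner_vec,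
    Finset.mul_sum]
  rw [Finset.sum_comm]
  refine Finset.sum_congr rfl fun g _ ↦ Finset.sum_congr rfl fun h _ ↦ ?_
  rw [map_mul, map_inv, RCLike.star_def]
  ring

end GroupAlgebra

variable {A : Type*} [CStarAlgebra A] {τ : A →L[ℂ] ℂ}

theorem lift_unitary_eq_zero_iff (hf : IsFaithfulFunctional τ) {j : unitary A →* Γ}
    (hj : ∀ u, χ (j u) = τ (u : A)) (x : MonoidAlgebra ℂ (unitary A)) :
    MonoidAlgebra.lift ℂ A (unitary A) (unitary A).subtype x = 0 ↔
      MonoidAlgebra.lift ℂ _ (unitary A) (R.leftHom.comp j) x = 0 := by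
  set P := MonoidAlgebra.lift ℂ A (unitary A) (unitary A).subtype x with hP
  set Q := MonoidAlgebra.lift ℂ _ (unitary A) (R.leftHom.comp j) x with hQ
  have hinner : inner ℂ ((Q : H →L[ℂ] H) (R.vec 1)) ((Q : H →L[ℂ] H) (R.vec 1)) =
      τ (star P * P) := by
    rw [hQ, inner_lift_leftHom_self, hP, MonoidAlgebra.lift_apply]
    simp only [hj]
    exact (apply_star_mul_sum_unitary _).symm
  refine ⟨fun h ↦ Subtype.ext (eq_zero_of_apply_vec_one Q.2 ?_), fun h ↦ hf _ ?_⟩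
  · rw [← inner_self_eq_zero (𝕜 := ℂ), hinner, h, mul_zero, map_zero]
  · rw [← hinner, h]
    simp

theorem exists_injective_starAlgHom (hf : IsFaithfulFunctional τ) {j : unitary A →* Γ}
    (hj : ∀ u, χ (j u) = τ (u : A)) :
    ∃ φ : A →⋆ₐ[ℂ] R.vonNeumannAlgebra.toStarSubalgebra, Function.Injective φ := by
  obtain ⟨φ, hinj, hφ⟩ := exists_injective_algHom_of_surjective lift_unitary_surjective
    (R.lift_unitary_eq_zero_iff hf hj)
  have hφu (u : unitary A) : φ u = R.leftHom (j u) := by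
    have := hφ (MonoidAlgebra.of ℂ _ u)
    rwa [MonoidAlgebra.lift_of, MonoidAlgebra.lift_of] at this
  refine ⟨⟨φ, map_star_of_map_star_unitary fun u ↦ ?_⟩, hinj⟩
  rw [← Unitary.coe_star, hφu, hφu, R.star_leftHom, Unitary.star_eq_inv, map_inv]

end CharacterRep

theorem mainTheorem8 (A : Type u) [CStarAlgebra A] :
    (∃ τ : A →L[ℂ] ℂ, IsTracialState τ ∧ IsFaithfulFunctional τ) ↔
      ∃ (H : Type u) (_ : NormedAddCommGroup H) (_ : InnerProductSpace ℂ H) (_ : CompleteSpace H)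
        (M : VonNeumannAlgebra H),
        M.IsFactor ∧ M.IsTypeIIOne ∧
          ∃ φ : A →⋆ₐ[ℂ] M.toStarSubalgebra, Function.Injective φ := by
  constructor
  · rintro ⟨τ, hτ, hf⟩
    let t : unitary A → ℂ := fun u ↦ τ (u : A)
    have h1 : t 1 = 1 := hτ.map_one
    have ht (k u) : t (k * u * k⁻¹) = t u := hτ.conj_unitary k u
    have hmix := WreathProduct.isMixingAlong_swap h1 ht
    obtain ⟨a, b, hab⟩ := WreathProduct.exists_character_commutator_eq_zero (unitary A) t
    obtain ⟨H, _, _, _, ⟨R⟩⟩ := exists_characterRep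
      (χ := fun g : WreathProduct.finitary (unitary A) ↦ WreathProduct.character t g)
      (WreathProduct.posSemidef_character h1 hτ.posSemidef)
      fun k g ↦ WreathProduct.character_conj ht k g
    exact ⟨H, _, _, _, R.vonNeumannAlgebra, R.isFactor hmix,
      CharacterRep.isTypeIIOne hmix (a := a) (b := b) (by simp [hab]),
      R.exists_injective_starAlgHom hf (WreathProduct.character_single h1)⟩
  · rintro ⟨H, _, _, _, M, hM, hII, φ, hφ⟩
    exact exists_faithful_tracialState_of_injective hM hII.finite φ hφ
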